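/- **The second-level specification of the separation kernel satisfies noninfluence.** *Security model.* Fix a set $\mathcal P$ of partitions and let $\mathcal D=\mathcal P\cup\{\mathbb S,\mathbb T\}$ (scheduler, transmitter). A model consists of states, an initial state $s_0$, events $e$ with transition relations $\varphi(e)$, a partial function $kdom(s,e)\in\mathcal D$, a relation $\leadsto$ on $\mathcal D$ and relations $\sim_d$ ($d\in\mathcal D$) on states. It is an *instance of* $\mathcal{SM}$ if (1) for distinct $p_1,p_2\in\mathcal P$, $p_1\leadsto p_2$ implies $p_1\leadsto\mathbb T$ and $\mathbb T\leadsto p_2$; (2) $\mathbb S\leadsto d$ for all $d$; (3) $d\leadsto\mathbb S$ implies $d=\mathbb S$; (4) each $\sim_d$ is an equivalence relation; (5) $s\sim_{\mathbb S}t$ implies $kdom(s,e)=kdom(t,e)$; (6) every event is enabled in every reachable state. Let $R(s)$ mean that $s$ is reachable from $s_0$, and let $s\triangleright es$ be the set of states reached from $s$ by executing the event sequence $es$. Put $sources([\,],s,d)=\{d\}$, and let $sources(e\#es,s,d)$ be the union of all $sources(es,s',d)$ with $(s,s')\in\varphi(e)$, together with $w=kdom(s,e)$ if $w\leadsto v$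 for some $v\in sources(es,s',d)$ and some $(s,s')\in\varphi(e)$. For a set $ss$ of states put $ipurge([\,],d,ss)=[\,]$; if $kdom(s,e)\in sources(e\#es,s,d)$ for some $s\in ss$, then $ipurge(e\#es,d,ss)=e\#ipurge(es,d,ss')$, where $ss'$ is the set of $e$-successors of $ss$; otherwise $ipurge(e\#es,d,ss)=ipurge(es,d,ss)$. Write $(s,es_1)\simeq_d(t,es_2)$ if $s'\sim_d t'$ for all $s'\in s\triangleright es_1$ and $t'\in t\triangleright es_2$. In the following, $s,t$ range over reachable states, and $s\approx^{es}_d t$ means that $s\sim_{\mathbb S}t$ and $s\sim_v t$ for all $v\in sources(es,s,d)$. * *noninfluence*: $s\approx^{es}_d t$ implies $(s,es)\simeq_d(t,ipurge(es,d,\{t\}))$; * *weak noninfluence*: $s\approx^{es_1}_d t$ and $ipurge(es_1,d,\{s\})=ipurge(es_2,d,\{t\})$ imply $(s,es_1)\simeq_d(t,es_2)$; * *nonleakage*: $s\approx^{es}_d t$ implies $(s,es)\simeq_d(t,es)$; * *noninterference\_r*: $(s,es)\simeq_d(s,ipurge(es,d,\{s\}))$; * *weak noninterference\_r*: $ipurge(es_1,d,\{s\})=ipurge(es_2,d,\{s\})$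 implies $(s,es_1)\simeq_d(s,es_2)$; * *noninterference* and *weak noninterference*: the last two for $s=s_0$ only. *Configuration.* Each of finitely or infinitely many ports has an identifier, a name, an owning partition, a direction (source or destination) and a mode (sampling, or queuing with a maximal number of messages). A queuing channel has a source and a destination port name, a sampling channel a source port name and a set of destination port names. The configuration is well formed: port names are unique, the ends of each channel are configured ports of the right mode and direction, and every port is an end of some channel. It also fixes the domain executing initially and a map giving, for each executing domain, the domain the partition scheduler selects next; these are always partitions or $\mathbb T$. The relation $\leadsto$ is reflexive, $\mathbb S\leadsto d$ for all $d$, $p\leadsto\mathbb T$ iff partition $p$ owns an end of a channel, $\mathbb T\leadsto p$ iff $p$ owns a destination end of a channel, and nothing else holds. *Top-level specification.* A state consists of the mode (IDLE, COLD\_START, WARM\_START, NORMAL) of each partition, the owners of created ports, the executing domain $cur$, and the created ports with their buffers. Initially all partitions are in COLD\_START and no port is created. A hypercall is executed by the partition $cur$ (it does nothing if $cur$ is not a partition) and has domain $cur$. The hypercalls are the ARINC 653 services: Create\_Sampling\_Port and Create\_Queuing\_Port (create a configured port of the current partition, when not yet created and not in NORMAL mode); Write\_Sampling\_Message and Send\_Queuing\_Message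 (put a message into a source port of the current partition; a sampling port is overwritten, and a message sent to a full queuing port is lost); Read\_Sampling\_Message (no state change); Receive\_Queuing\_Message and Clear\_Queuing\_Port (remove the first, respectively all, messages of a destination queuing port of the current partition); Get\_{Sampling,Queuing}\_Port\_Id, Get\_{Sampling,Queuing}\_Port\_Status and Get\_Partition\_Status (no state change); and Set\_Partition\_Mode (set the mode of the current partition, except from COLD\_START to WARM\_START). The system events are Schedule (domain $\mathbb S$; updates $cur$ by the selection map) and, with domain $\mathbb T$ and effective only if $cur=\mathbb T$ and the channel is configured, the transmission of a message on a sampling channel (copied to all created destination ports) or on a queuing channel (if both ports are created and the source port has a message, its first message is removed and appended to the destination port, or lost if that is full). Equivalence: $s\sim_{\mathbb S}t$ iff $cur$ agrees; $s\sim_{\mathbb T}t$ iff all created ports with their owners and states agree; for a partition $p$, $s\sim_p t$ iff the mode of $p$, its set of created ports, which of these are queuing ports and which are destination ports, and the number of messages in each of its destination ports agree. *Second-level specification.* The state is extended, for each partition, by its set of created processes, its current process if any, and the state (DORMANT, READY, RUNNING, WAITING) and priority of each process; initially there are no processes. The events are those of the top level and the following, which have domain $cur$, have no effect if $cur$ is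 not a partition, and act on processes of the current partition only. Create\_Process: outside NORMAL mode, create a DORMANT process with an identifier unused in the partition. Start\_Process: DORMANT becomes READY in NORMAL mode and WAITING otherwise. Stop\_Process: the process becomes DORMANT. Suspend\_Process: READY or RUNNING becomes WAITING. Resume\_Process: WAITING becomes READY in NORMAL mode. Set\_Priority: change the priority of a process that is not DORMANT. Get\_Process\_Status: no state change. (A stopped or suspended process is no longer the current one.) Process scheduling: in NORMAL mode, the running current process becomes READY, and then, if some process is READY, one of the READY processes of highest priority (selected by a fixed choice function on sets of identifiers) becomes RUNNING and the current process. Set\_Partition\_Mode, when it takes effect, moreover makes the WAITING processes of the partition READY if the new mode is NORMAL, and deletes all its processes if the mode changes from NORMAL to another one. All other top-level events leave the new variables unchanged. Let $s\sim^{\Delta}_d t$ mean, for a partition $d$, that its processes, their states and priorities, and its current process agree, and let it always hold for $d\in\{\mathbb S,\mathbb T\}$. The state equivalence at the second level is the top-level one together with $\sim^{\Delta}$. **Theorem.** For every well-formed configuration: 1. The second-level specification is an instance of $\mathcal{SM}$. 2. It refines the top-level specification. Let $\Psi$ forget the process variables, and let $\Theta$ send each top-level event to itself and each new event to $\tau$.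 Then $\Psi$ maps the initial state to the initial state; every top-level event is in the range of $\Theta$; a step of an event $e$ with $\Theta(e)\ne\tau$ is mapped by $\Psi$ to a top-level step of $\Theta(e)$, and $kdom(s,e)=kdom(\Psi(s),\Theta(e))$; a step of an event with $\Theta(e)=\tau$ does not change $\Psi$ of the state; $\leadsto$ is the same at both levels; and $s\sim_d t$ holds iff $\Psi(s)\sim_d\Psi(t)$ and $s\sim^{\Delta}_d t$. 3. It satisfies the unwinding conditions on the new state variables for every event $e$ and every $d\in\mathcal D$. Step consistency: if $s,t$ are reachable, $s\sim_d t$, $s\sim_{\mathbb S}t$, $kdom(s,e)\leadsto d$, $s\sim_{kdom(s,e)}t$, $(s,s')\in\varphi(e)$ and $(t,t')\in\varphi(e)$, then $s'\sim^{\Delta}_d t'$. Local respect: if $s$ is reachable, $kdom(s,e)\not\leadsto d$ and $(s,s')\in\varphi(e)$, then $s\sim^{\Delta}_d s'$. 4. It satisfies noninfluence, and also weak noninfluence, nonleakage, noninterference\_r, weak noninterference\_r, noninterference and weak noninterference. -/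

import Mathlib

namespace ArincSK

/-! ## Security model -/

/-- Security domains of a kernel whose configured partitions are the elements of `P`:
the scheduler, the message transmitter, and the partitions. -/
inductive Domain (P : Type) where
  | sched : Domain P
  | trans : Domain P
  | part (p : P) : Domain P

/-- A nondeterministic state machine together with a security configuration: domain of events
(a partial function), interference relation, and state equivalence for each domain. -/
structure SecModel (P S E : Type) where
  init : S
  step : E → Set (S × S)
  kdom : S → E → Option (Domain P)
  intf : Domain P → Domain P → Prop
  equiv : Domain P → S → S → Prop

namespace SecModel

section
variable {P S E : Type} (M : SecModel P S E)

/-- Execution of a sequence of events; the head of the list is executed first. -/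
def run : List E → Set (S × S)
  | [] => {x | x.1 = x.2}
  | e :: es => {x | ∃ u, (x.1, u) ∈ M.step e ∧ (u, x.2) ∈ run es}

def execution (s : S) (es : List E) : Set S := {t | (s, t) ∈ M.run es}

def Reachable (s : S) : Prop := ∃ es, (M.init, s) ∈ M.run es

/-- Equivalence of two states for all domains of a set. -/
def EquivDoms (s : S) (D : Set (Domain P)) (t : S) : Prop := ∀ d ∈ D, M.equiv d s t

/-- Observational equivalence for `d` of executing `es₁` from `s` and `es₂` from `t`. -/
def EquivExec (s : S) (es₁ : List E) (d : Domain P) (t : S) (es₂ : List E) : Prop :=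
  ∀ s' ∈ M.execution s es₁, ∀ t' ∈ M.execution t es₂, M.equiv d s' t'

def sources : List E → S → Domain P → Set (Domain P)
  | [], _, d => {d}
  | e :: es, s, d =>
      {v | ∃ s', (s, s') ∈ M.step e ∧ v ∈ sources es s' d} ∪
      {w | M.kdom s e = some w ∧
        ∃ v s', M.intf w v ∧ (s, s') ∈ M.step e ∧ v ∈ sources es s' d}

open Classical in
noncomputable def ipurge : List E → Domain P → Set S → List E
  | [], _, _ => []
  | e :: es, d, ss =>
      if ∃ s ∈ ss, ∃ w, M.kdom s e = some w ∧ w ∈ M.sources (e :: es) s d then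
        e :: ipurge es d {s' | ∃ s ∈ ss, (s, s') ∈ M.step e}
      else
        ipurge es d ss

/-- The assumptions of the security model. -/
structure IsSM : Prop where
  part_intf : ∀ p₁ p₂ : P, p₁ ≠ p₂ → M.intf (.part p₁) (.part p₂) →
    M.intf (.part p₁) .trans ∧ M.intf .trans (.part p₂)
  sched_intf : ∀ d, M.intf .sched d
  intf_sched : ∀ d, M.intf d .sched → d = .sched
  equivalence : ∀ d, Equivalence (M.equiv d)
  kdom_sched : ∀ s t e, M.equiv .sched s t → M.kdom s e = M.kdom t e
  enabled : ∀ s e, M.Reachable s → ∃ s', (s, s') ∈ M.step e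

/-! ### Information-flow security properties -/

def Noninterference : Prop :=
  ∀ d es, M.EquivExec M.init es d M.init (M.ipurge es d {M.init})

def WeakNoninterference : Prop :=
  ∀ d es₁ es₂, M.ipurge es₁ d {M.init} = M.ipurge es₂ d {M.init} →
    M.EquivExec M.init es₁ d M.init es₂

def NoninterferenceR : Prop :=
  ∀ d es s, M.Reachable s → M.EquivExec s es d s (M.ipurge es d {s})

def WeakNoninterferenceR : Prop :=
  ∀ d es₁ es₂ s, M.Reachable s → M.ipurge es₁ d {s} = M.ipurge es₂ d {s} →
    M.EquivExec s es₁ d s es₂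

def Nonleakage : Prop :=
  ∀ d es s t, M.Reachable s → M.Reachable t → M.equiv .sched s t →
    M.EquivDoms s (M.sources es s d) t → M.EquivExec s es d t es

def WeakNoninfluence : Prop :=
  ∀ d es₁ es₂ s t, M.Reachable s → M.Reachable t → M.EquivDoms s (M.sources es₁ s d) t →
    M.equiv .sched s t → M.ipurge es₁ d {s} = M.ipurge es₂ d {t} →
    M.EquivExec s es₁ d t es₂

def Noninfluence : Prop :=
  ∀ d es s t, M.Reachable s → M.Reachable t → M.EquivDoms s (M.sources es s d) t →
    M.equiv .sched s t → M.EquivExec s es d t (M.ipurge es d {t})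

/-! ### Unwinding conditions relative to the equivalence `Δ` on the new state variables -/

/-- Step consistency of the event `e` on the new state variables. -/
def StepConsistentΔ (Δ : Domain P → S → S → Prop) (e : E) : Prop :=
  ∀ d s t, M.Reachable s → M.Reachable t → M.equiv d s t → M.equiv .sched s t →
    ∀ w, M.kdom s e = some w → M.intf w d → M.equiv w s t →
      ∀ s' t', (s, s') ∈ M.step e → (t, t') ∈ M.step e → Δ d s' t'

/-- Local respect of the event `e` on the new state variables. -/
def LocallyRespectsΔ (Δ : Domain P → S → S → Prop) (e : E) : Prop :=
  ∀ d s s', M.Reachable s → (¬ ∃ w, M.kdom s e = some w ∧ M.intf w d) →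
    (s, s') ∈ M.step e → Δ d s s'

end

end SecModel

/-! ## Functional specifications and refinement -/

/-- A functional specification: execution model and event specification `F`. -/
structure FuncSpec (P S E : Type) where
  init : S
  F : E → S → Set S
  kdom : S → E → Option (Domain P)
  intf : Domain P → Domain P → Prop
  equiv : Domain P → S → S → Prop

/-- The execution model of a functional specification. -/
def FuncSpec.model {P S E : Type} (K : FuncSpec P S E) : SecModel P S E where
  init := K.init
  step := fun e => {x | x.2 ∈ K.F e x.1}
  kdom := K.kdom
  intf := K.intf
  equiv := K.equiv

/-- `C` refines `A` by the state relation `Ψ` and the event relation `Θ` (`none` is the silent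
event), where `Δ` is the state equivalence on the new state variables.  That both have the same
security domains is in the types. -/
structure Refines {P SA EA SC EC : Type} (A : SecModel P SA EA) (C : SecModel P SC EC)
    (Ψ : SC → SA) (Θ : EC → Option EA) (Δ : Domain P → SC → SC → Prop) : Prop where
  init : Ψ C.init = A.init
  surj : ∀ a : EA, ∃ e : EC, Θ e = some a
  simulation : ∀ e a s t, Θ e = some a → (s, t) ∈ C.step e → (Ψ s, Ψ t) ∈ A.step a
  silent : ∀ e s t, Θ e = none → (s, t) ∈ C.step e → Ψ t = Ψ s
  kdom : ∀ e a s, Θ e = some a → C.kdom s e = A.kdom (Ψ s) a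
  intf : ∀ d₁ d₂, C.intf d₁ d₂ ↔ A.intf d₁ d₂
  equiv : ∀ d s t, C.equiv d s t ↔ (A.equiv d (Ψ s) (Ψ t) ∧ Δ d s t)

/-! ## System configuration -/

abbrev PortId := ℕ
abbrev PortName := String
abbrev ChannelName := String
abbrev ProcId := ℕ

inductive PortDir where
  | source
  | destination

inductive PortMode where
  | sampling
  | queuing (maxMsgs : ℕ)

/-- Configuration of a port; port identifiers are fixed in the configuration. -/
structure PortConf (P : Type) where
  name : PortName
  owner : P
  dir : PortDir
  mode : PortMode

/-- A queuing channel has one destination port, a sampling channel a set of them. -/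
inductive Channel where
  | queuing (c : ChannelName) (src dst : PortName)
  | sampling (c : ChannelName) (src : PortName) (dsts : Set PortName)

def Channel.src : Channel → PortName
  | .queuing _ sn _ => sn
  | .sampling _ sn _ => sn

def Channel.dsts : Channel → Set PortName
  | .queuing _ _ dn => {dn}
  | .sampling _ _ dns => dns

/-- Static configuration of a kernel with partitions `P`.  `start` is the domain executing
initially.  The partition scheduler chooses some partition or the transmitter, independently of the
states of the partitions: `next d` is its choice while `d` executes.  The map `next` is arbitrary; a
constant one is the choice of a fixed element of the set of partitions and the transmitter. -/
structure SysConfig (P : Type) where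
  ports : PortId → Option (PortConf P)
  channels : Set Channel
  start : Domain P
  next : Domain P → Domain P

/-- The configuration constraints: port names are unique, the ends of a channel are configured
ports of the right mode and direction, every port is an end of a channel, and the executing domain
is always a partition or the transmitter. -/
structure SysConfig.WellFormed {P : Type} (conf : SysConfig P) : Prop where
  name_unique : ∀ i j pc pc', conf.ports i = some pc → conf.ports j = some pc' →
    pc.name = pc'.name → i = j
  queuing_src : ∀ c sn dn, Channel.queuing c sn dn ∈ conf.channels →
    ∃ i pc n, conf.ports i = some pc ∧ pc.name = sn ∧ pc.dir = .source ∧ pc.mode = .queuing n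
  queuing_dst : ∀ c sn dn, Channel.queuing c sn dn ∈ conf.channels →
    ∃ i pc n, conf.ports i = some pc ∧ pc.name = dn ∧ pc.dir = .destination ∧
      pc.mode = .queuing n
  sampling_src : ∀ c sn dns, Channel.sampling c sn dns ∈ conf.channels →
    ∃ i pc, conf.ports i = some pc ∧ pc.name = sn ∧ pc.dir = .source ∧ pc.mode = .sampling
  sampling_dst : ∀ c sn dns, Channel.sampling c sn dns ∈ conf.channels → ∀ dn ∈ dns,
    ∃ i pc, conf.ports i = some pc ∧ pc.name = dn ∧ pc.dir = .destination ∧ pc.mode = .sampling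
  port_on_channel : ∀ i pc, conf.ports i = some pc →
    ∃ c ∈ conf.channels, pc.name = c.src ∨ pc.name ∈ c.dsts
  start_ne : conf.start ≠ .sched
  next_ne : ∀ d, conf.next d ≠ .sched

/-- Partition `p` has a port on some channel. -/
def SysConfig.PartIntfTrm {P : Type} (conf : SysConfig P) (p : P) : Prop :=
  ∃ i pc c, conf.ports i = some pc ∧ pc.owner = p ∧ c ∈ conf.channels ∧
    (pc.name = c.src ∨ pc.name ∈ c.dsts)

/-- Partition `p` has a destination port on some channel. -/
def SysConfig.TrmIntfPart {P : Type} (conf : SysConfig P) (p : P) : Prop :=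
  ∃ i pc c, conf.ports i = some pc ∧ pc.owner = p ∧ c ∈ conf.channels ∧ pc.name ∈ c.dsts

/-- The interference relation, at both levels of specification. -/
def SysConfig.Interference {P : Type} (conf : SysConfig P) : Domain P → Domain P → Prop
  | .sched, _ => True
  | .trans, .sched => False
  | .trans, .trans => True
  | .trans, .part p => conf.TrmIntfPart p
  | .part _, .sched => False
  | .part p, .trans => conf.PartIntfTrm p
  | .part p, .part q => p = q

/-! ## Top-level specification -/

inductive PartMode where
  | idle
  | coldStart
  | warmStart
  | normal

/-- A created port with its message buffer. -/
inductive PortState (Msg : Type) where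
  | sampling (name : PortName) (dir : PortDir) (msg : Option Msg)
  | queuing (name : PortName) (maxMsgs : ℕ) (dir : PortDir) (buf : List Msg)

namespace PortState

section
variable {Msg : Type}

def name : PortState Msg → PortName
  | .sampling n _ _ => n
  | .queuing n _ _ _ => n

def dir : PortState Msg → PortDir
  | .sampling _ d _ => d
  | .queuing _ _ d _ => d

def IsQueuing : PortState Msg → Prop
  | .sampling _ _ _ => False
  | .queuing _ _ _ _ => True

/-- The messages in the buffer, the oldest one first. -/
def msgs : PortState Msg → List Msg
  | .sampling _ _ m => m.toList
  | .queuing _ _ _ b => b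

/-- A queuing port is full when its buffer has the configured maximal length; a sampling port is
never full, since a new message overwrites the old one. -/
def IsFull : PortState Msg → Prop
  | .sampling _ _ _ => False
  | .queuing _ k _ b => k ≤ b.length

def insert (m : Msg) : PortState Msg → PortState Msg
  | .sampling n d _ => .sampling n d (some m)
  | .queuing n k d b => .queuing n k d (b ++ [m])

/-- Remove the oldest message of a queuing port. -/
def removeFirst : PortState Msg → PortState Msg
  | .sampling n d m => .sampling n d m
  | .queuing n k d b => .queuing n k d b.tail

/-- Remove all messages of a queuing port. -/
def clear : PortState Msg → PortState Msg
  | .sampling n d m => .sampling n d m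
  | .queuing n k d _ => .queuing n k d []

end

end PortState

/-- The port, with empty buffer, that is created from its configuration. -/
def PortConf.newPort {P : Type} (Msg : Type) (pc : PortConf P) : PortState Msg :=
  match pc.mode with
  | .sampling => .sampling pc.name pc.dir none
  | .queuing k => .queuing pc.name k pc.dir []

structure State (P Msg : Type) where
  partitions : P → Option PartMode
  partPorts : PortId → Option P
  cur : Domain P
  comm : PortId → Option (PortState Msg)

inductive Hypercall (Msg : Type) where
  | createSamplingPort (n : PortName)
  | writeSamplingMessage (i : PortId) (m : Msg)
  | readSamplingMessage (i : PortId)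
  | getSamplingPortId (n : PortName)
  | getSamplingPortStatus (i : PortId)
  | createQueuingPort (n : PortName)
  | sendQueuingMessage (i : PortId) (m : Msg)
  | receiveQueuingMessage (i : PortId)
  | getQueuingPortId (n : PortName)
  | getQueuingPortStatus (i : PortId)
  | clearQueuingPort (i : PortId)
  | setPartitionMode (m : PartMode)
  | getPartitionStatus

inductive SysEvent where
  | schedule
  | transferSamplingMessage (c : Channel)
  | transferQueuingMessage (c : Channel)

inductive Event (Msg : Type) where
  | hyperc (h : Hypercall Msg)
  | sys (e : SysEvent)

noncomputable section TopLevel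

open scoped Classical

variable {P Msg : Type}

namespace State

def IsQueuingPort (s : State P Msg) (i : PortId) : Prop :=
  ∃ pt, s.comm i = some pt ∧ pt.IsQueuing

def IsSamplingPort (s : State P Msg) (i : PortId) : Prop :=
  ∃ pt, s.comm i = some pt ∧ ¬ pt.IsQueuing

def IsSourcePort (s : State P Msg) (i : PortId) : Prop :=
  ∃ pt, s.comm i = some pt ∧ pt.dir = .source

def IsDestPort (s : State P Msg) (i : PortId) : Prop :=
  ∃ pt, s.comm i = some pt ∧ pt.dir = .destination

def IsPortOf (s : State P Msg) (i : PortId) (p : P) : Prop := s.partPorts i = some p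

def IsFullPort (s : State P Msg) (i : PortId) : Prop :=
  ∃ pt, s.comm i = some pt ∧ pt.IsFull

def HasMsg (s : State P Msg) (i : PortId) : Prop :=
  ∃ pt, s.comm i = some pt ∧ pt.msgs ≠ []

/-- The messages in the buffer of a port; empty if the port has not been created. -/
def msgsOf (s : State P Msg) (i : PortId) : List Msg :=
  match s.comm i with
  | some pt => pt.msgs
  | none => []

/-- Apply a function to a port; nothing changes if the port has not been created. -/
def modifyPort (s : State P Msg) (i : PortId) (f : PortState Msg → PortState Msg) :
    State P Msg :=
  { s with comm := Function.update s.comm i ((s.comm i).map f) }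

/-- The identifier of the created port with a given name. -/
def portIdByName (s : State P Msg) (n : PortName) : Option PortId :=
  if h : ∃ i pt, s.comm i = some pt ∧ pt.name = n then some h.choose else none

end State

/-- The port with name `n` that is configured for partition `p`. -/
def SysConfig.cfgPort (conf : SysConfig P) (p : P) (n : PortName) :
    Option (PortId × PortConf P) :=
  if h : ∃ x : PortId × PortConf P, conf.ports x.1 = some x.2 ∧ x.2.name = n ∧ x.2.owner = p
  then some h.choose else none

/-- Kernel initialization: all partitions in cold start, no port created. -/
def systemInit (conf : SysConfig P) : State P Msg where
  partitions := fun _ => some .coldStart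
  partPorts := fun _ => none
  cur := conf.start
  comm := fun _ => none

/-- Partition scheduling. -/
def schedule (conf : SysConfig P) (s : State P Msg) : State P Msg :=
  { s with cur := conf.next s.cur }

/-! ### Hypercalls
In what follows, `p` is the partition that is currently executing.  A service returns the new state
and its result. -/

/-- Create the configured port `x` of partition `p`, unless it has been created already. Ports
cannot be created in normal mode. -/
def createPort (s : State P Msg) (p : P) (x : PortId × PortConf P) :
    State P Msg × Option PortId :=
  if s.comm x.1 = none ∧ s.partitions p ≠ some .normal then
    ({ s with
        comm := Function.update s.comm x.1 (some (x.2.newPort Msg))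
        partPorts := Function.update s.partPorts x.1 (some p) }, some x.1)
  else (s, none)

def createSamplingPort (conf : SysConfig P) (s : State P Msg) (p : P) (n : PortName) :
    State P Msg × Option PortId :=
  match conf.cfgPort p n with
  | some x => if x.2.mode = .sampling then createPort s p x else (s, none)
  | none => (s, none)

def createQueuingPort (conf : SysConfig P) (s : State P Msg) (p : P) (n : PortName) :
    State P Msg × Option PortId :=
  match conf.cfgPort p n with
  | some x => if x.2.mode ≠ .sampling then createPort s p x else (s, none)
  | none => (s, none)

def writeSamplingMessage (s : State P Msg) (p : P) (i : PortId) (m : Msg) : State P Msg × Bool :=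
  if ¬ s.IsSamplingPort i ∨ ¬ s.IsSourcePort i ∨ ¬ s.IsPortOf i p then (s, false)
  else (s.modifyPort i (PortState.insert m), true)

/-- Reading a sampling port does not consume the message. -/
def readSamplingMessage (s : State P Msg) (p : P) (i : PortId) : State P Msg × Option Msg :=
  if ¬ s.IsSamplingPort i ∨ ¬ s.IsDestPort i ∨ ¬ s.IsPortOf i p then (s, none)
  else (s, (s.msgsOf i).head?)

/-- Sending to a full port omits the message. -/
def sendQueuingMessage (s : State P Msg) (p : P) (i : PortId) (m : Msg) : State P Msg × Bool :=
  if ¬ s.IsQueuingPort i ∨ ¬ s.IsSourcePort i ∨ ¬ s.IsPortOf i p then (s, false)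
  else if s.IsFullPort i then (s, true)
  else (s.modifyPort i (PortState.insert m), true)

def receiveQueuingMessage (s : State P Msg) (p : P) (i : PortId) : State P Msg × Option Msg :=
  if ¬ s.IsQueuingPort i ∨ ¬ s.IsDestPort i ∨ ¬ s.IsPortOf i p ∨ ¬ s.HasMsg i then (s, none)
  else (s.modifyPort i PortState.removeFirst, (s.msgsOf i).head?)

def clearQueuingPort (s : State P Msg) (p : P) (i : PortId) : State P Msg × Bool :=
  if ¬ s.IsQueuingPort i ∨ ¬ s.IsDestPort i ∨ ¬ s.IsPortOf i p then (s, false)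
  else (s.modifyPort i PortState.clear, true)

/-- The identifier of a created port of the current partition with the given name; used for
sampling ports and for queuing ports. -/
def getPortId (s : State P Msg) (p : P) (n : PortName) : State P Msg × Option PortId :=
  (s, (s.portIdByName n).filter (fun i => decide (s.IsPortOf i p)))

/-- The status of a port of the current partition. -/
def getPortStatus (s : State P Msg) (p : P) (i : PortId) : State P Msg × Option (PortState Msg) :=
  (s, if s.IsPortOf i p then s.comm i else none)

/-- The change from cold start to warm start is not allowed. -/
def setPartitionMode (s : State P Msg) (p : P) (m : PartMode) : State P Msg :=
  if s.partitions p ≠ none ∧ ¬ (s.partitions p = some .coldStart ∧ m = .warmStart) then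
    { s with partitions := Function.update s.partitions p (some m) }
  else s

def getPartitionStatus (s : State P Msg) (p : P) : State P Msg × Option PartMode :=
  (s, s.partitions p)

/-- The state after a hypercall of partition `p`. -/
def execHypercall (conf : SysConfig P) (s : State P Msg) (p : P) : Hypercall Msg → State P Msg
  | .createSamplingPort n => (createSamplingPort conf s p n).1
  | .writeSamplingMessage i m => (writeSamplingMessage s p i m).1
  | .readSamplingMessage i => (readSamplingMessage s p i).1
  | .getSamplingPortId n => (getPortId s p n).1
  | .getSamplingPortStatus i => (getPortStatus s p i).1
  | .createQueuingPort n => (createQueuingPort conf s p n).1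
  | .sendQueuingMessage i m => (sendQueuingMessage s p i m).1
  | .receiveQueuingMessage i => (receiveQueuingMessage s p i).1
  | .getQueuingPortId n => (getPortId s p n).1
  | .getQueuingPortStatus i => (getPortStatus s p i).1
  | .clearQueuingPort i => (clearQueuingPort s p i).1
  | .setPartitionMode m => setPartitionMode s p m
  | .getPartitionStatus => (getPartitionStatus s p).1

/-! ### Message transmission -/

/-- Transmission on a sampling channel: the message of the source port is copied to all created
destination ports. -/
def transferSampling (s : State P Msg) : Channel → State P Msg
  | .sampling _ sn dns =>
    match s.portIdByName sn with
    | some sp =>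
      match (s.msgsOf sp).head? with
      | some m =>
        { s with
            comm := fun i =>
              (s.comm i).map (fun pt => if pt.name ∈ dns then pt.insert m else pt) }
      | none => s
    | none => s
  | .queuing _ _ _ => s

/-- Transmission on a queuing channel: the first message of the source port is removed and put into
the destination port; it is lost when the destination port is full. -/
def transferQueuing (s : State P Msg) : Channel → State P Msg
  | .queuing _ sn dn =>
    match s.portIdByName sn, s.portIdByName dn with
    | some sp, some dp =>
      match (s.msgsOf sp).head? with
      | some m =>
        let s' := s.modifyPort sp PortState.removeFirst
        if s'.IsFullPort dp then s' else s'.modifyPort dp (PortState.insert m)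
      | none => s
    | _, _ => s
  | .sampling _ _ _ => s

/-! ### Events, domains and state equivalence -/

/-- The event specification.  Hypercalls are executed when a partition is executing, and messages are
transmitted, on configured channels, when the transmitter is executing; otherwise the state does
not change. -/
def execEvent (conf : SysConfig P) : Event Msg → State P Msg → Set (State P Msg)
  | .hyperc h, s =>
    match s.cur with
    | .part p => {execHypercall conf s p h}
    | _ => {s}
  | .sys .schedule, s => {schedule conf s}
  | .sys (.transferSamplingMessage c), s =>
    if s.cur = .trans ∧ c ∈ conf.channels then {transferSampling s c} else {s}
  | .sys (.transferQueuingMessage c), s =>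
    if s.cur = .trans ∧ c ∈ conf.channels then {transferQueuing s c} else {s}

/-- The domain of an event; that of a hypercall is the current executing domain. -/
def eventDomain (s : State P Msg) : Event Msg → Option (Domain P)
  | .hyperc _ => some s.cur
  | .sys .schedule => some .sched
  | .sys (.transferSamplingMessage _) => some .trans
  | .sys (.transferQueuingMessage _) => some .trans

/-- Same communication abilities of partition `d`: the same ports, of the same kind, with the same
number of messages in destination ports. -/
def VpeqPartComm (s : State P Msg) (d : P) (t : State P Msg) : Prop :=
  (∀ i, s.IsPortOf i d ↔ t.IsPortOf i d) ∧
  ∀ i, s.IsPortOf i d →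
    (s.IsQueuingPort i ↔ t.IsQueuingPort i) ∧
    (s.IsDestPort i ↔ t.IsDestPort i) ∧
    (s.IsDestPort i → (s.msgsOf i).length = (t.msgsOf i).length)

def VpeqPart (s : State P Msg) (d : P) (t : State P Msg) : Prop :=
  s.partitions d = t.partitions d ∧ VpeqPartComm s d t

def Vpeq : Domain P → State P Msg → State P Msg → Prop
  | .sched, s, t => s.cur = t.cur
  | .trans, s, t => s.comm = t.comm ∧ s.partPorts = t.partPorts
  | .part d, s, t => VpeqPart s d t

/-- The top-level specification. -/
def topSpec (Msg : Type) (conf : SysConfig P) : FuncSpec P (State P Msg) (Event Msg) where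
  init := systemInit conf
  F := execEvent conf
  kdom := eventDomain
  intf := conf.Interference
  equiv := Vpeq

end TopLevel

/-! ## Second-level specification -/

inductive ProcStatus where
  | dormant
  | ready
  | running
  | waiting

structure ProcState where
  state : ProcStatus
  priority : ℕ

/-- The state extended by the processes: the created processes of a partition, its current executing
process, and the states of processes.  Process identifiers are separate for each partition. -/
structure StateR (P Msg : Type) extends State P Msg where
  procs : P → Option (Set ProcId)
  curProc : P → Option ProcId
  procState : P × ProcId → Option ProcState

/-- Process management services. -/
inductive ProcCall where
  | createProc (priority : ℕ)
  | startProc (q : ProcId)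
  | stopProc (q : ProcId)
  | suspendProc (q : ProcId)
  | resumeProc (q : ProcId)
  | setPriority (q : ProcId) (priority : ℕ)
  | getProcStatus (q : ProcId)

/-- The events: those of the top level, the process management services, and process scheduling. -/
inductive EventR (Msg : Type) where
  | base (e : Event Msg)
  | proc (h : ProcCall)
  | scheduleProc

noncomputable section SecondLevel

open scoped Classical

variable {P Msg : Type}

namespace StateR

/-- `q` is a created process of partition `p` with process state `st`. -/
def HasProc (s : StateR P Msg) (p : P) (q : ProcId) (st : ProcState) : Prop :=
  (∃ ps, s.procs p = some ps ∧ q ∈ ps) ∧ s.procState (p, q) = some st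

def setProc (s : StateR P Msg) (p : P) (q : ProcId) (st : ProcState) : StateR P Msg :=
  { s with procState := Function.update s.procState (p, q) (some st) }

/-- Process `q` of partition `p` is not the current process any more. -/
def dropCur (s : StateR P Msg) (p : P) (q : ProcId) : StateR P Msg :=
  if s.curProc p = some q then { s with curProc := Function.update s.curProc p none } else s

/-- Change of the state of process `q` of partition `p` by `f`; nothing changes when `q` is not a
created process of `p`. -/
def modifyProc (s : StateR P Msg) (p : P) (q : ProcId) (f : ProcState → ProcState) :
    StateR P Msg :=
  match s.procState (p, q) with
  | some st => if s.HasProc p q st then s.setProc p q (f st) else s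
  | none => s

end StateR

/-! ### Process management
As before, `p` is the current executing partition. -/

/-- A new process is dormant; its identifier is one that is not used in the current partition.
Processes cannot be created in normal mode. -/
def createProc (s : StateR P Msg) (p : P) (priority : ℕ) : StateR P Msg × Option ProcId :=
  match s.procs p with
  | some ps =>
    if s.partitions p ≠ some .normal then
      let q := Classical.epsilon (fun q : ProcId => q ∉ ps)
      ({ s with
          procs := Function.update s.procs p (some (Insert.insert q ps))
          procState := Function.update s.procState (p, q) (some ⟨.dormant, priority⟩) }, some q)
    else (s, none)
  | none => (s, none)

/-- A dormant process becomes ready in normal mode and waiting in the other modes. -/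
def startProc (s : StateR P Msg) (p : P) (q : ProcId) : StateR P Msg :=
  s.modifyProc p q (fun st =>
    if st.state = .dormant then
      { st with state := if s.partitions p = some .normal then .ready else .waiting }
    else st)

/-- A stopped process becomes dormant. -/
def stopProc (s : StateR P Msg) (p : P) (q : ProcId) : StateR P Msg :=
  (s.modifyProc p q (fun st => { st with state := .dormant })).dropCur p q

/-- A ready or running process becomes waiting when it is suspended. -/
def suspendProc (s : StateR P Msg) (p : P) (q : ProcId) : StateR P Msg :=
  (s.modifyProc p q (fun st =>
    if st.state = .ready ∨ st.state = .running then { st with state := .waiting }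
    else st)).dropCur p q

/-- A waiting process becomes ready when it is resumed in normal mode. -/
def resumeProc (s : StateR P Msg) (p : P) (q : ProcId) : StateR P Msg :=
  s.modifyProc p q (fun st =>
    if st.state = .waiting ∧ s.partitions p = some .normal then { st with state := .ready }
    else st)

/-- The priority of a dormant process cannot be changed. -/
def setPriority (s : StateR P Msg) (p : P) (q : ProcId) (priority : ℕ) : StateR P Msg :=
  s.modifyProc p q (fun st =>
    if st.state = .dormant then st else { st with priority := priority })

def getProcStatus (s : StateR P Msg) (p : P) (q : ProcId) : StateR P Msg × Option ProcState :=
  (s, s.procState (p, q))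

/-- The state after a process management service called by partition `p`. -/
def execProcCall (s : StateR P Msg) (p : P) : ProcCall → StateR P Msg
  | .createProc priority => (createProc s p priority).1
  | .startProc q => startProc s p q
  | .stopProc q => stopProc s p q
  | .suspendProc q => suspendProc s p q
  | .resumeProc q => resumeProc s p q
  | .setPriority q priority => setPriority s p q priority
  | .getProcStatus q => (getProcStatus s p q).1

/-! ### Process scheduling -/

/-- The running current process of partition `p`, if any, becomes ready. -/
def setRunToReady (s : StateR P Msg) (p : P) : StateR P Msg :=
  match s.curProc p with
  | some q => s.modifyProc p q (fun st =>
      if st.state = .running then { st with state := .ready } else st)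
  | none => s

/-- The ready processes of partition `p`. -/
def readyProcs (s : StateR P Msg) (p : P) : Set ProcId :=
  {q | ∃ st, s.HasProc p q st ∧ st.state = .ready}

/-- The ready processes of partition `p` with the highest priority. -/
def topReadyProcs (s : StateR P Msg) (p : P) : Set ProcId :=
  {q | ∃ st, s.HasProc p q st ∧ st.state = .ready ∧
    ∀ q' ∈ readyProcs s p, ∀ st', s.procState (p, q') = some st' → st'.priority ≤ st.priority}

/-- Priority-based process scheduling in the current partition, which takes place in normal mode
only.  If no process is ready, then none is selected. -/
def scheduleProc (s : StateR P Msg) : Set (StateR P Msg) :=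
  match s.cur with
  | .part p =>
    if s.partitions p = some .normal then
      let s' := setRunToReady s p
      if (topReadyProcs s' p).Nonempty then
        let q := Classical.epsilon (fun q : ProcId => q ∈ topReadyProcs s' p)
        {{ s'.modifyProc p q (fun st => { st with state := .running }) with
            curProc := Function.update s'.curProc p (some q) }}
      else {s'}
    else {s}
  | _ => {s}

/-! ### Refined events -/

/-- When the partition enters normal mode, its waiting processes become ready. -/
def setProcsToNormal (s : StateR P Msg) (p : P) : StateR P Msg :=
  { s with procState := fun x =>
      if x.1 = p then
        (s.procState x).map (fun st =>
          if st.state = .waiting then { st with state := .ready } else st)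
      else s.procState x }

/-- Deletion of all processes of a partition. -/
def removePartitionResources (s : StateR P Msg) (p : P) : StateR P Msg :=
  { s with
      procs := Function.update s.procs p (some ∅)
      curProc := Function.update s.curProc p none
      procState := fun x => if x.1 = p then none else s.procState x }

def setPartitionModeR (s : StateR P Msg) (p : P) (m : PartMode) : StateR P Msg :=
  if s.partitions p ≠ none ∧ ¬ (s.partitions p = some .coldStart ∧ m = .warmStart) then
    let s' :=
      if m = .normal then setProcsToNormal s p
      else if s.partitions p = some .normal then removePartitionResources s p
      else s
    { s' with partitions := Function.update s.partitions p (some m) }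
  else s

/-- The event specification.  Except for the change of the partition mode, events of the top level do
not touch the new state variables. -/
def execEventR (conf : SysConfig P) : EventR Msg → StateR P Msg → Set (StateR P Msg)
  | .base (.hyperc (.setPartitionMode m)), s =>
    match s.cur with
    | .part p => {setPartitionModeR s p m}
    | _ => {s}
  | .base e, s => {s' | ∃ u ∈ execEvent conf e s.toState, s' = { s with toState := u }}
  | .proc h, s =>
    match s.cur with
    | .part p => {execProcCall s p h}
    | _ => {s}
  | .scheduleProc, s => scheduleProc s

/-- The domain of the new events is the current executing domain. -/
def eventDomainR (s : StateR P Msg) : EventR Msg → Option (Domain P)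
  | .base e => eventDomain s.toState e
  | .proc _ => some s.cur
  | .scheduleProc => some s.cur

/-- State equivalence on the new state variables: for a partition, the same processes, states of
processes, and current process. -/
def VpeqΔ : Domain P → StateR P Msg → StateR P Msg → Prop
  | .sched, _, _ => True
  | .trans, _, _ => True
  | .part d, s, t =>
    s.procs d = t.procs d ∧ (∀ q, s.procState (d, q) = t.procState (d, q)) ∧
      s.curProc d = t.curProc d

def VpeqR (d : Domain P) (s t : StateR P Msg) : Prop :=
  Vpeq d s.toState t.toState ∧ VpeqΔ d s t

def systemInitR (conf : SysConfig P) : StateR P Msg where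
  toState := systemInit conf
  procs := fun _ => some ∅
  curProc := fun _ => none
  procState := fun _ => none

/-- The second-level specification. -/
def secondSpec (Msg : Type) (conf : SysConfig P) : FuncSpec P (StateR P Msg) (EventR Msg) where
  init := systemInitR conf
  F := execEventR conf
  kdom := eventDomainR
  intf := conf.Interference
  equiv := VpeqR

/-- The event relation: the process events are new. -/
def evtRel : EventR Msg → Option (Event Msg)
  | .base e => some e
  | .proc _ => none
  | .scheduleProc => none

end SecondLevel

end ArincSK

/-!
The proof has two general parts and two that concern the kernel.

For any model that satisfies the assumptions of the security model, step consistency and local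
respect of the whole state (`SecModel.Unwinding`) imply all the security properties. Write `s ≈ t`
for equivalence for the scheduler and for all sources of `d` along `es`. A common event preserves
`≈` (`IsSM.sourcesEquiv_step`), and so does, on one side only, an event whose domain is not a source
(`IsSM.sourcesEquiv_of_purged`). Noninfluence follows by induction on the sequence of events, once
it is stated for purging relative to a set of states (`IsSM.equiv_of_ipurge`). Since `≈`-equivalent
states have the same purged sequences (`IsSM.ipurge_congr`), weak noninfluence follows by comparing
both executions with an execution of the common purged sequence. The other properties are special
cases.

Refinement transports unwinding: the abstract variables inherit it from the abstract model, and
silent events leave these variables alone, so only the new variables need to be considered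
(`Refines.unwinding`).

At the top level, unwinding rests on an invariant of reachable states, `State.Inv`: created ports
have the name, the direction and the owner of their configuration. Every port is on a channel, so
that a partition which cannot interfere with the transmitter owns no port; and the transmitter
changes, for a partition that it cannot interfere with, at most source ports, whose contents the
partition does not observe. A partition observes the guards of its own services: whether one of its
configured ports has been created, and whether one of its destination ports holds a message.

At the second level, all events that touch processes are operations on the processes of the
executing partition that depend on nothing but these processes and the mode of the partition
(`ProcLocal`). Unwinding on the new variables follows from this alone.
-/

namespace ArincSK

/-! ### Unwinding for nondeterministic security models -/

namespace SecModel

variable {P S E : Type} {M : SecModel P S E}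

/-- The unwinding conditions on the whole state: step consistency and local respect of all events
with respect to the state equivalence of the model itself. -/
structure Unwinding (M : SecModel P S E) : Prop where
  stepConsistent : ∀ e, M.StepConsistentΔ M.equiv e
  locallyRespects : ∀ e, M.LocallyRespectsΔ M.equiv e

/-- The relation `s ≈ t` of the security properties: both states are reachable, and equivalent for
the scheduler and for all sources of `d` along `es`. -/
structure SourcesEquiv (M : SecModel P S E) (es : List E) (d : Domain P) (s t : S) : Prop where
  left : M.Reachable s
  right : M.Reachable t
  sched : M.equiv .sched s t
  doms : M.EquivDoms s (M.sources es s d) t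

theorem run_append_singleton {es : List E} {e : E} {s t u : S} (h : (s, t) ∈ M.run es)
    (h' : (t, u) ∈ M.step e) : (s, u) ∈ M.run (es ++ [e]) := by
  induction es generalizing s with
  | nil =>
    obtain rfl : s = t := h
    exact ⟨u, h', rfl⟩
  | cons a es ih =>
    obtain ⟨v, hv, hr⟩ := h
    exact ⟨v, hv, ih hr⟩

theorem Reachable.step {s t : S} {e : E} (hs : M.Reachable s) (h : (s, t) ∈ M.step e) :
    M.Reachable t :=
  hs.elim fun es hes => ⟨es ++ [e], run_append_singleton hes h⟩

theorem reachable_init : M.Reachable M.init := ⟨[], rfl⟩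

theorem Reachable.induction {p : S → Prop} (h0 : p M.init)
    (hstep : ∀ e s t, p s → (s, t) ∈ M.step e → p t) {s : S} (hs : M.Reachable s) : p s := by
  obtain ⟨es, hes⟩ := hs
  suffices ∀ es u, p u → (u, s) ∈ M.run es → p s from this es _ h0 hes
  intro es
  induction es with
  | nil =>
    intro u hu h
    obtain rfl : u = s := h
    exact hu
  | cons e es ih => rintro u hu ⟨v, hv, hr⟩; exact ih v (hstep e u v hu hv) hr

theorem subset_sources_cons {e : E} {es : List E} {s s' : S} {d : Domain P}
    (h : (s, s') ∈ M.step e) : M.sources es s' d ⊆ M.sources (e :: es) s d :=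
  fun _ hv => Or.inl ⟨s', h, hv⟩

theorem kdom_mem_sources_cons {e : E} {es : List E} {s s' : S} {d v w : Domain P}
    (hw : M.kdom s e = some w) (hv : M.intf w v) (h : (s, s') ∈ M.step e)
    (hs : v ∈ M.sources es s' d) : w ∈ M.sources (e :: es) s d :=
  Or.inr ⟨hw, v, s', hv, h, hs⟩

namespace IsSM

variable (hM : M.IsSM)
include hM

theorem exists_execution (es : List E) {s : S} (hs : M.Reachable s) :
    ∃ t, t ∈ M.execution s es := by
  induction es generalizing s with
  | nil => exact ⟨s, rfl⟩
  | cons e es ih =>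
    obtain ⟨u, hu⟩ := hM.enabled s e hs
    obtain ⟨t, ht⟩ := ih (hs.step hu)
    exact ⟨t, u, hu, ht⟩

theorem self_mem_sources (es : List E) {s : S} (hs : M.Reachable s) (d : Domain P) :
    d ∈ M.sources es s d := by
  induction es generalizing s with
  | nil => exact rfl
  | cons e es ih =>
    obtain ⟨u, hu⟩ := hM.enabled s e hs
    exact subset_sources_cons hu (ih (hs.step hu))

theorem sourcesEquiv_refl (es : List E) {s : S} (hs : M.Reachable s) (d : Domain P) :
    M.SourcesEquiv es d s s :=
  ⟨hs, hs, (hM.equivalence _).refl s, fun v _ => (hM.equivalence v).refl s⟩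

/-- An event preserves the relation `≈`: the equivalences that its domain can influence are
preserved by step consistency, the others by local respect on both sides. -/
theorem sourcesEquiv_step (hU : M.Unwinding) {e : E} {es : List E} {d : Domain P} {s t s' t' : S}
    (h : M.SourcesEquiv (e :: es) d s t) (hs : (s, s') ∈ M.step e) (ht : (t, t') ∈ M.step e) :
    M.SourcesEquiv es d s' t' := by
  have hk := hM.kdom_sched s t e h.sched
  have key : ∀ v, M.equiv v s t →
      (∀ w, M.kdom s e = some w → M.intf w v → M.equiv w s t) → M.equiv v s' t' := by
    intro v hv hw
    by_cases hi : ∃ w, M.kdom s e = some w ∧ M.intf w v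
    · obtain ⟨w, hkw, hwv⟩ := hi
      exact hU.stepConsistent e v s t h.left h.right hv h.sched w hkw hwv (hw w hkw hwv) s' t' hs ht
    · have h1 := hU.locallyRespects e v s s' h.left hi hs
      have h2 := hU.locallyRespects e v t t' h.right (hk ▸ hi) ht
      have hE := hM.equivalence v
      exact hE.trans (hE.symm h1) (hE.trans hv h2)
  refine ⟨h.left.step hs, h.right.step ht, key _ h.sched fun w _ hw => ?_, fun v hv => ?_⟩
  -- Only the scheduler itself can influence the scheduler.
  · rw [hM.intf_sched w hw]
    exact h.sched
  · exact key v (h.doms v (subset_sources_cons hs hv)) fun w hkw hwv =>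
      h.doms w (kdom_mem_sources_cons hkw hwv hs hv)

theorem sources_congr (hU : M.Unwinding) {es : List E} {d : Domain P} {s t : S}
    (h : M.SourcesEquiv es d s t) : M.sources es s d = M.sources es t d := by
  induction es generalizing s t with
  | nil => rfl
  | cons e es ih =>
    have hk := hM.kdom_sched s t e h.sched
    have hst : ∀ s' t', (s, s') ∈ M.step e → (t, t') ∈ M.step e →
        M.sources es s' d = M.sources es t' d :=
      fun s' t' hs ht => ih (hM.sourcesEquiv_step hU h hs ht)
    obtain ⟨s₁, hs₁⟩ := hM.enabled s e h.left
    obtain ⟨t₁, ht₁⟩ := hM.enabled t e h.right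
    ext v
    constructor
    · rintro (⟨s', hs, hv⟩ | ⟨hw, u, s', hi, hs, hu⟩)
      · exact Or.inl ⟨t₁, ht₁, hst s' t₁ hs ht₁ ▸ hv⟩
      · exact Or.inr ⟨hk ▸ hw, u, t₁, hi, ht₁, hst s' t₁ hs ht₁ ▸ hu⟩
    · rintro (⟨t', ht, hv⟩ | ⟨hw, u, t', hi, ht, hu⟩)
      · exact Or.inl ⟨s₁, hs₁, hst s₁ t' hs₁ ht ▸ hv⟩
      · exact Or.inr ⟨hk ▸ hw, u, s₁, hi, hs₁, hst s₁ t' hs₁ ht ▸ hu⟩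

/-- An event whose domain is not a source of `d` cannot be noticed by the sources of `d`.  In
particular its domain is not the scheduler, which interferes with every domain. -/
theorem sourcesEquiv_of_purged (hU : M.Unwinding) {e : E} {es : List E} {d : Domain P} {s s' : S}
    (hs : M.Reachable s) (hn : ¬ ∃ w, M.kdom s e = some w ∧ w ∈ M.sources (e :: es) s d)
    (h : (s, s') ∈ M.step e) : M.SourcesEquiv es d s' s := by
  have hl : ∀ v, (¬ ∃ w, M.kdom s e = some w ∧ M.intf w v) → M.equiv v s' s := fun v hv =>
    (hM.equivalence v).symm (hU.locallyRespects e v s s' hs hv h)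
  refine ⟨hs.step h, hs, hl _ ?_, fun v hv => hl v ?_⟩
  · rintro ⟨w, hw, hi⟩
    refine hn ⟨w, hw, kdom_mem_sources_cons hw ?_ h (hM.self_mem_sources es (hs.step h) d)⟩
    rw [hM.intf_sched w hi]
    exact hM.sched_intf d
  · rintro ⟨w, hw, hi⟩
    exact hn ⟨w, hw, kdom_mem_sources_cons hw hi h hv⟩

/-- If the domain of `e` is not a source of `d` along `e :: es`, then `≈` along `e :: es` implies
`≈` along `es`. -/
theorem sourcesEquiv_tail (hU : M.Unwinding) {e : E} {es : List E} {d : Domain P} {s t : S}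
    (hn : ¬ ∃ w, M.kdom s e = some w ∧ w ∈ M.sources (e :: es) s d)
    (h : M.SourcesEquiv (e :: es) d s t) : M.SourcesEquiv es d s t := by
  obtain ⟨s', hs'⟩ := hM.enabled s e h.left
  have hp := hM.sourcesEquiv_of_purged hU h.left hn hs'
  refine ⟨h.left, h.right, h.sched, fun v hv => h.doms v (subset_sources_cons hs' ?_)⟩
  rwa [hM.sources_congr hU hp]

theorem kdom_mem_sources_congr (hU : M.Unwinding) {e : E} {es : List E} {d : Domain P} {s t : S}
    (h : M.SourcesEquiv es d s t) :
    (∃ w, M.kdom s e = some w ∧ w ∈ M.sources es s d) ↔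
      ∃ w, M.kdom t e = some w ∧ w ∈ M.sources es t d := by
  rw [hM.kdom_sched s t e h.sched, hM.sources_congr hU h]

theorem ipurge_congr (hU : M.Unwinding) {es : List E} {d : Domain P} {ss tt : Set S}
    (hs : ss.Nonempty) (ht : tt.Nonempty)
    (h : ∀ s ∈ ss, ∀ t ∈ tt, M.SourcesEquiv es d s t) : M.ipurge es d ss = M.ipurge es d tt := by
  induction es generalizing ss tt with
  | nil => rfl
  | cons e es ih =>
    obtain ⟨s₀, hs₀⟩ := hs
    obtain ⟨t₀, ht₀⟩ := ht
    have hiff : (∃ s ∈ ss, ∃ w, M.kdom s e = some w ∧ w ∈ M.sources (e :: es) s d) ↔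
        ∃ t ∈ tt, ∃ w, M.kdom t e = some w ∧ w ∈ M.sources (e :: es) t d :=
      ⟨fun ⟨s, hs, hw⟩ => ⟨t₀, ht₀, (hM.kdom_mem_sources_congr hU (h s hs t₀ ht₀)).1 hw⟩,
        fun ⟨t, ht, hw⟩ => ⟨s₀, hs₀, (hM.kdom_mem_sources_congr hU (h s₀ hs₀ t ht)).2 hw⟩⟩
    by_cases hc : ∃ s ∈ ss, ∃ w, M.kdom s e = some w ∧ w ∈ M.sources (e :: es) s d
    · rw [ipurge, ipurge, if_pos hc, if_pos (hiff.1 hc)]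
      congr 1
      obtain ⟨s₁, hs₁⟩ := hM.enabled s₀ e (h s₀ hs₀ t₀ ht₀).left
      obtain ⟨t₁, ht₁⟩ := hM.enabled t₀ e (h s₀ hs₀ t₀ ht₀).right
      refine ih ⟨s₁, s₀, hs₀, hs₁⟩ ⟨t₁, t₀, ht₀, ht₁⟩ ?_
      rintro s' ⟨s, hs, hss⟩ t' ⟨t, ht, htt⟩
      exact hM.sourcesEquiv_step hU (h s hs t ht) hss htt
    · rw [ipurge, ipurge, if_neg hc, if_neg (mt hiff.2 hc)]
      exact ih ⟨s₀, hs₀⟩ ⟨t₀, ht₀⟩ fun s hs t ht =>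
        hM.sourcesEquiv_tail hU (fun hw => hc ⟨s, hs, hw⟩) (h s hs t ht)

/-- Noninfluence for purging relative to a set of states, which is the form that is proved by
induction on the sequence of events. -/
theorem equiv_of_ipurge (hU : M.Unwinding) {es : List E} {d : Domain P} {s s' t t' : S}
    {tt : Set S} (h : ∀ t ∈ tt, M.SourcesEquiv es d s t) (ht : t ∈ tt)
    (hs' : s' ∈ M.execution s es) (ht' : t' ∈ M.execution t (M.ipurge es d tt)) :
    M.equiv d s' t' := by
  induction es generalizing s t tt with
  | nil =>
    obtain rfl : s = s' := hs'
    obtain rfl : t = t' := ht'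
    exact (h t ht).doms d rfl
  | cons e es ih =>
    obtain ⟨s₁, hs₁, hr⟩ := hs'
    rw [ipurge] at ht'
    split_ifs at ht' with hc
    · obtain ⟨t₁, ht₁, hr'⟩ := ht'
      refine ih (tt := {s' | ∃ s ∈ tt, (s, s') ∈ M.step e}) ?_ ⟨t, ht, ht₁⟩ hr hr'
      rintro u' ⟨u, hu, huu⟩
      exact hM.sourcesEquiv_step hU (h u hu) hs₁ huu
    · have hn : ¬ ∃ w, M.kdom s e = some w ∧ w ∈ M.sources (e :: es) s d := fun hw =>
        hc ⟨t, ht, (hM.kdom_mem_sources_congr hU (h t ht)).1 hw⟩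
      refine ih (fun u hu => ?_) ht hr ht'
      have h1 := hM.sourcesEquiv_of_purged hU (h u hu).left hn hs₁
      have h2 := h u hu
      exact ⟨h1.left, h2.right, (hM.equivalence _).trans h1.sched h2.sched, fun v hv =>
        (hM.equivalence v).trans (h1.doms v hv) (h2.doms v (subset_sources_cons hs₁ hv))⟩

theorem noninfluence (hU : M.Unwinding) : M.Noninfluence := by
  intro d es s t hs ht hd hS s' hs' t' ht'
  refine hM.equiv_of_ipurge hU ?_ (Set.mem_singleton t) hs' ht'
  rintro _ rfl
  exact ⟨hs, ht, hS, hd⟩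

/-- Both executions are compared with an execution of the common purged sequence from `t`. -/
theorem weakNoninfluence (hU : M.Unwinding) : M.WeakNoninfluence := by
  intro d es₁ es₂ s t hs ht hd hS hp s' hs' t' ht'
  have hst : M.ipurge es₁ d {s} = M.ipurge es₁ d {t} := by
    refine hM.ipurge_congr hU (Set.singleton_nonempty s) (Set.singleton_nonempty t) ?_
    rintro _ rfl _ rfl
    exact ⟨hs, ht, hS, hd⟩
  obtain ⟨u, hu⟩ := hM.exists_execution (M.ipurge es₂ d {t}) ht
  have h1 := hM.noninfluence hU d es₁ s t hs ht hd hS s' hs' u (by rwa [← hst, hp])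
  have hr := hM.sourcesEquiv_refl es₂ ht d
  have h2 := hM.noninfluence hU d es₂ t t ht ht hr.doms hr.sched t' ht' u hu
  exact (hM.equivalence d).trans h1 ((hM.equivalence d).symm h2)

theorem nonleakage (hU : M.Unwinding) : M.Nonleakage := by
  intro d es s t hs ht hS hd
  refine hM.weakNoninfluence hU d es es s t hs ht hd hS ?_
  refine hM.ipurge_congr hU (Set.singleton_nonempty s) (Set.singleton_nonempty t) ?_
  rintro _ rfl _ rfl
  exact ⟨hs, ht, hS, hd⟩

theorem noninterferenceR (hU : M.Unwinding) : M.NoninterferenceR := fun d es s hs =>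
  have hr := hM.sourcesEquiv_refl es hs d
  hM.noninfluence hU d es s s hs hs hr.doms hr.sched

theorem weakNoninterferenceR (hU : M.Unwinding) : M.WeakNoninterferenceR :=
  fun d es₁ es₂ s hs hp =>
    have hr := hM.sourcesEquiv_refl es₁ hs d
    hM.weakNoninfluence hU d es₁ es₂ s s hs hs hr.doms hr.sched hp

theorem noninterference (hU : M.Unwinding) : M.Noninterference := fun d es =>
  hM.noninterferenceR hU d es _ reachable_init

theorem weakNoninterference (hU : M.Unwinding) : M.WeakNoninterference := fun d es₁ es₂ =>
  hM.weakNoninterferenceR hU d es₁ es₂ _ reachable_init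

end IsSM

end SecModel

/-! ### Unwinding and refinement -/

namespace Refines

variable {P SA EA SC EC : Type} {A : SecModel P SA EA} {C : SecModel P SC EC} {Ψ : SC → SA}
  {Θ : EC → Option EA} {Δ : Domain P → SC → SC → Prop}

theorem reachable (h : Refines A C Ψ Θ Δ) {s : SC} (hs : C.Reachable s) : A.Reachable (Ψ s) := by
  refine hs.induction (p := fun s => A.Reachable (Ψ s)) (h.init ▸ SecModel.reachable_init) ?_
  intro e s t hs ht
  cases he : Θ e with
  | none => rwa [h.silent e s t he ht]
  | some a => exact hs.step (h.simulation e a s t he ht)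

/-- The unwinding conditions of the abstract model carry over to the variables of the abstract
state, since silent events do not change them; so only the new variables remain to be considered. -/
theorem unwinding (h : Refines A C Ψ Θ Δ) (hA : A.Unwinding)
    (hsc : ∀ e, C.StepConsistentΔ Δ e) (hlr : ∀ e, C.LocallyRespectsΔ Δ e)
    (hrefl : ∀ d s, A.equiv d s s) : C.Unwinding where
  stepConsistent e d s t hs ht hd hS w hw hi hwe s' t' hs' ht' := by
    refine (h.equiv _ _ _).2 ⟨?_, hsc e d s t hs ht hd hS w hw hi hwe s' t' hs' ht'⟩
    cases he : Θ e with
    | none =>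
      rw [h.silent e s s' he hs', h.silent e t t' he ht']
      exact ((h.equiv _ _ _).1 hd).1
    | some a =>
      exact hA.stepConsistent a d (Ψ s) (Ψ t) (h.reachable hs) (h.reachable ht)
        ((h.equiv _ _ _).1 hd).1 ((h.equiv _ _ _).1 hS).1 w (h.kdom e a s he ▸ hw)
        ((h.intf _ _).1 hi) ((h.equiv _ _ _).1 hwe).1 _ _
        (h.simulation e a s s' he hs') (h.simulation e a t t' he ht')
  locallyRespects e d s s' hs hn hs' := by
    refine (h.equiv _ _ _).2 ⟨?_, hlr e d s s' hs hn hs'⟩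
    cases he : Θ e with
    | none =>
      rw [h.silent e s s' he hs']
      exact hrefl _ _
    | some a =>
      refine hA.locallyRespects a d (Ψ s) (Ψ s') (h.reachable hs) ?_ (h.simulation e a s s' he hs')
      rintro ⟨w, hw, hi⟩
      exact hn ⟨w, (h.kdom e a s he).trans hw, (h.intf _ _).2 hi⟩

end Refines

/-! ### Ports of the top level -/

section TopLevel

open scoped Classical

variable {P Msg : Type} {conf : SysConfig P}

namespace PortState

/-- The function does not change the name, direction and kind of a port, and the number of messages
of the result depends only on the kind and the number of messages of the port. -/
structure Regular (f : PortState Msg → PortState Msg) : Prop where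
  name : ∀ pt, (f pt).name = pt.name
  dir : ∀ pt, (f pt).dir = pt.dir
  isQueuing : ∀ pt, (f pt).IsQueuing ↔ pt.IsQueuing
  length_msgs : ∀ pt pt', (pt.IsQueuing ↔ pt'.IsQueuing) → pt.msgs.length = pt'.msgs.length →
    (f pt).msgs.length = (f pt').msgs.length

theorem regular_insert (m : Msg) : Regular (insert m) where
  name pt := by cases pt <;> rfl
  dir pt := by cases pt <;> rfl
  isQueuing pt := by cases pt <;> rfl
  length_msgs pt pt' := by cases pt <;> cases pt' <;> simp [insert, msgs, IsQueuing]

theorem regular_removeFirst : Regular (removeFirst : PortState Msg → PortState Msg) where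
  name pt := by cases pt <;> rfl
  dir pt := by cases pt <;> rfl
  isQueuing pt := by cases pt <;> rfl
  length_msgs pt pt' := by
    cases pt <;> cases pt' <;> simp +contextual [removeFirst, msgs, IsQueuing]

theorem regular_clear : Regular (clear : PortState Msg → PortState Msg) where
  name pt := by cases pt <;> rfl
  dir pt := by cases pt <;> rfl
  isQueuing pt := by cases pt <;> rfl
  length_msgs pt pt' := by cases pt <;> cases pt' <;> simp [clear, msgs, IsQueuing]

end PortState

theorem PortConf.newPort_name (pc : PortConf P) : (pc.newPort Msg).name = pc.name := by
  unfold newPort; split <;> rfl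

theorem PortConf.newPort_dir (pc : PortConf P) : (pc.newPort Msg).dir = pc.dir := by
  unfold newPort; split <;> rfl

theorem SysConfig.cfgPort_eq_some {p : P} {n : PortName} {x : PortId × PortConf P}
    (h : conf.cfgPort p n = some x) :
    conf.ports x.1 = some x.2 ∧ x.2.name = n ∧ x.2.owner = p := by
  unfold cfgPort at h
  split_ifs at h with hx
  obtain rfl := Option.some.inj h
  exact hx.choose_spec

namespace State

/-- The created ports are configured ports with their configured owners, names and directions, and
only created ports have owners. -/
structure Inv (conf : SysConfig P) (s : State P Msg) : Prop where
  owner_eq_none : ∀ i, s.comm i = none → s.partPorts i = none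
  configured : ∀ i pt, s.comm i = some pt → ∃ pc, conf.ports i = some pc ∧ pc.name = pt.name ∧
    pc.dir = pt.dir ∧ s.partPorts i = some pc.owner

theorem inv_init : Inv conf (systemInit conf : State P Msg) := ⟨fun _ _ => rfl, nofun⟩

/-- The invariant is preserved by changes of port states that keep names and directions. -/
theorem Inv.of_map {s t : State P Msg} (h : s.Inv conf) (ho : t.partPorts = s.partPorts)
    {f : PortId → PortState Msg → PortState Msg} (hc : ∀ i, t.comm i = (s.comm i).map (f i))
    (hn : ∀ i pt, (f i pt).name = pt.name) (hd : ∀ i pt, (f i pt).dir = pt.dir) :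
    t.Inv conf where
  owner_eq_none i hi := by
    rw [hc, Option.map_eq_none_iff] at hi
    rw [ho, h.owner_eq_none i hi]
  configured i pt hi := by
    rw [hc, Option.map_eq_some_iff] at hi
    obtain ⟨pt', hi, rfl⟩ := hi
    rw [hn, hd, ho]
    exact h.configured i pt' hi

theorem modifyPort_comm (s : State P Msg) (i j : PortId) (f : PortState Msg → PortState Msg) :
    (s.modifyPort i f).comm j = (s.comm j).map (if j = i then f else id) := by
  by_cases hj : j = i
  · subst hj; simp [modifyPort]
  · simp [modifyPort, hj]

theorem Inv.modifyPort {s : State P Msg} (h : s.Inv conf) (i : PortId)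
    {f : PortState Msg → PortState Msg} (hf : PortState.Regular f) :
    (s.modifyPort i f).Inv conf := by
  refine h.of_map rfl (fun j => s.modifyPort_comm i j f) ?_ ?_ <;> intro j pt <;> split_ifs
  exacts [hf.name pt, rfl, hf.dir pt, rfl]

theorem portIdByName_eq_some {s : State P Msg} {n : PortName} {i : PortId}
    (h : s.portIdByName n = some i) : ∃ pt, s.comm i = some pt ∧ pt.name = n := by
  unfold portIdByName at h
  split_ifs at h with hx
  obtain rfl := Option.some.inj h
  exact hx.choose_spec

theorem portIdByName_congr {s t : State P Msg} (h : s.comm = t.comm) (n : PortName) :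
    s.portIdByName n = t.portIdByName n := by
  unfold portIdByName
  rw [h]

theorem Inv.exists_conf {s : State P Msg} (h : s.Inv conf) {i : PortId} {p : P}
    (hi : s.IsPortOf i p) :
    ∃ pc pt, conf.ports i = some pc ∧ pc.owner = p ∧ s.comm i = some pt ∧ pc.name = pt.name ∧
      pc.dir = pt.dir := by
  cases hc : s.comm i with
  | none => exact absurd (hi.symm.trans (h.owner_eq_none i hc)) nofun
  | some pt =>
    obtain ⟨pc, h1, h2, h3, h4⟩ := h.configured i pt hc
    exact ⟨pc, pt, h1, Option.some.inj (h4.symm.trans hi), rfl, h2, h3⟩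

/-- A partition that owns a created port can interfere with the transmitter. -/
theorem Inv.partIntfTrm {s : State P Msg} (h : s.Inv conf) (hconf : conf.WellFormed) {i : PortId}
    {p : P} (hi : s.IsPortOf i p) : conf.PartIntfTrm p := by
  obtain ⟨pc, pt, h1, h2, -⟩ := h.exists_conf hi
  obtain ⟨c, hc, hc'⟩ := hconf.port_on_channel i pc h1
  exact ⟨i, pc, c, h1, h2, hc, hc'⟩

theorem Inv.trmIntfPart {s : State P Msg} (h : s.Inv conf) {i : PortId} {p : P}
    (hi : s.IsPortOf i p) {c : Channel} (hc : c ∈ conf.channels) {pt : PortState Msg}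
    (hpt : s.comm i = some pt) (hn : pt.name ∈ c.dsts) : conf.TrmIntfPart p := by
  obtain ⟨pc, pt', h1, h2, h3, h4, -⟩ := h.exists_conf hi
  obtain rfl := Option.some.inj (hpt.symm.trans h3)
  exact ⟨i, pc, c, h1, h2, hc, h4 ▸ hn⟩

end State

/-! ### State equivalence of the top level -/

theorem VpeqPartComm.refl (s : State P Msg) (d : P) : VpeqPartComm s d s :=
  ⟨fun _ => Iff.rfl, fun _ _ => ⟨Iff.rfl, Iff.rfl, fun _ => rfl⟩⟩

theorem VpeqPartComm.symm {s t : State P Msg} {d : P} (h : VpeqPartComm s d t) :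
    VpeqPartComm t d s := by
  refine ⟨fun i => (h.1 i).symm, fun i hi => ?_⟩
  obtain ⟨h1, h2, h3⟩ := h.2 i ((h.1 i).2 hi)
  exact ⟨h1.symm, h2.symm, fun hd => (h3 (h2.2 hd)).symm⟩

theorem VpeqPartComm.trans {s t u : State P Msg} {d : P} (h : VpeqPartComm s d t)
    (h' : VpeqPartComm t d u) : VpeqPartComm s d u := by
  refine ⟨fun i => (h.1 i).trans (h'.1 i), fun i hi => ?_⟩
  obtain ⟨h1, h2, h3⟩ := h.2 i hi
  obtain ⟨h1', h2', h3'⟩ := h'.2 i ((h.1 i).1 hi)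
  exact ⟨h1.trans h1', h2.trans h2', fun hd => (h3 hd).trans (h3' (h2.1 hd))⟩

theorem vpeq_equivalence (d : Domain P) : Equivalence (Vpeq (Msg := Msg) d) := by
  cases d with
  | sched => exact ⟨fun _ => rfl, Eq.symm, Eq.trans⟩
  | trans =>
    exact ⟨fun _ => ⟨rfl, rfl⟩, fun h => ⟨h.1.symm, h.2.symm⟩,
      fun h h' => ⟨h.1.trans h'.1, h.2.trans h'.2⟩⟩
  | part p =>
    exact ⟨fun s => ⟨rfl, .refl s p⟩, fun h => ⟨h.1.symm, h.2.symm⟩,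
      fun h h' => ⟨h.1.trans h'.1, h.2.trans h'.2⟩⟩

/-- Equality of all ports of `d` implies the same communication abilities of `d`. -/
theorem VpeqPartComm.of_comm_eq {s t : State P Msg} {d : P}
    (ho : ∀ i, s.IsPortOf i d ↔ t.IsPortOf i d) (hc : ∀ i, s.IsPortOf i d → s.comm i = t.comm i) :
    VpeqPartComm s d t := by
  refine ⟨ho, fun i hi => ?_⟩
  simp only [State.IsQueuingPort, State.IsDestPort, State.msgsOf, hc i hi, implies_true, and_self]

/-- The same regular change of a port on both sides preserves the equivalence. -/
theorem VpeqPartComm.modifyPort {s t : State P Msg} {d : P} (h : VpeqPartComm s d t) (i : PortId)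
    {f : PortState Msg → PortState Msg} (hf : PortState.Regular f) :
    VpeqPartComm (s.modifyPort i f) d (t.modifyPort i f) := by
  refine ⟨h.1, fun j hj => ?_⟩
  obtain ⟨h1, h2, h3⟩ := h.2 j hj
  by_cases hji : j = i
  swap
  · simpa [State.IsQueuingPort, State.IsDestPort, State.msgsOf, State.modifyPort_comm, hji]
      using h.2 j hj
  subst hji
  simp only [State.IsQueuingPort, State.IsDestPort, State.msgsOf, State.modifyPort_comm, if_pos]
    at h1 h2 h3 ⊢
  cases hs : s.comm j <;> cases ht : t.comm j <;>
    simp_all [hf.isQueuing, hf.dir]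
  exact fun hd => hf.length_msgs _ _ h1 (h3 hd)

/-- A change of a port that is not a destination port of `d` cannot be observed by `d`. -/
theorem vpeqPartComm_modifyPort {s : State P Msg} {d : P} {i : PortId}
    {f : PortState Msg → PortState Msg} (hf : PortState.Regular f)
    (h : s.IsPortOf i d → ¬ s.IsDestPort i) : VpeqPartComm s d (s.modifyPort i f) := by
  refine ⟨fun _ => Iff.rfl, fun j hj => ?_⟩
  by_cases hji : j = i
  · subst hji
    have := h hj
    simp only [State.IsQueuingPort, State.IsDestPort, State.msgsOf, State.modifyPort_comm, if_pos]
      at this ⊢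
    cases hs : s.comm j <;> simp_all [hf.isQueuing, hf.dir]
  · simp [State.IsQueuingPort, State.IsDestPort, State.msgsOf, State.modifyPort_comm, hji]

/-! ### Hypercalls of the top level -/

/-- The possible effects of a hypercall of partition `p` in state `s`. -/
inductive HypercallEffect (conf : SysConfig P) (s : State P Msg) (p : P) : State P Msg → Prop
  | none : HypercallEffect conf s p s
  | mode (m : PartMode) : HypercallEffect conf s p
      { s with partitions := Function.update s.partitions p (some m) }
  | create (i : PortId) (pc : PortConf P) (hpc : conf.ports i = some pc) (ho : pc.owner = p)
      (hi : s.comm i = .none) : HypercallEffect conf s p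
      { s with
        comm := Function.update s.comm i (some (pc.newPort Msg))
        partPorts := Function.update s.partPorts i (some p) }
  | modify (i : PortId) (f : PortState Msg → PortState Msg) (hf : PortState.Regular f)
      (hi : s.IsPortOf i p) : HypercallEffect conf s p (s.modifyPort i f)

theorem hypercallEffect_createPort (s : State P Msg) {p : P} {n : PortName}
    {x : PortId × PortConf P} (hx : conf.cfgPort p n = some x) :
    HypercallEffect conf s p (createPort s p x).1 := by
  obtain ⟨h1, -, h3⟩ := SysConfig.cfgPort_eq_some hx
  unfold createPort
  split_ifs with h
  · exact .create x.1 x.2 h1 h3 h.1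
  · exact .none

theorem hypercallEffect (conf : SysConfig P) (s : State P Msg) (p : P) (h : Hypercall Msg) :
    HypercallEffect conf s p (execHypercall conf s p h) := by
  cases h with
  | createSamplingPort n =>
    simp only [execHypercall, createSamplingPort]
    split
    · split_ifs
      exacts [hypercallEffect_createPort s ‹_›, .none]
    · exact .none
  | createQueuingPort n =>
    simp only [execHypercall, createQueuingPort]
    split
    · split_ifs
      exacts [hypercallEffect_createPort s ‹_›, .none]
    · exact .none
  | writeSamplingMessage i m =>
    simp only [execHypercall, writeSamplingMessage]
    split_ifs with hc
    · exact .none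
    · exact .modify i _ (PortState.regular_insert m) (by tauto)
  | readSamplingMessage i =>
    simp only [execHypercall, readSamplingMessage]
    split_ifs <;> exact .none
  | sendQueuingMessage i m =>
    simp only [execHypercall, sendQueuingMessage]
    split_ifs with hc
    · exact .none
    · exact .none
    · exact .modify i _ (PortState.regular_insert m) (by tauto)
  | receiveQueuingMessage i =>
    simp only [execHypercall, receiveQueuingMessage]
    split_ifs with hc
    · exact .none
    · exact .modify i _ PortState.regular_removeFirst (by tauto)
  | clearQueuingPort i =>
    simp only [execHypercall, clearQueuingPort]
    split_ifs with hc
    · exact .none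
    · exact .modify i _ PortState.regular_clear (by tauto)
  | setPartitionMode m =>
    simp only [execHypercall, setPartitionMode]
    split_ifs
    · exact .mode m
    · exact .none
  | _ => exact .none

namespace HypercallEffect

variable {s t : State P Msg} {p : P}

theorem inv (h : HypercallEffect conf s p t) (hs : s.Inv conf) : t.Inv conf := by
  cases h with
  | none => exact hs
  | mode m => exact ⟨hs.owner_eq_none, hs.configured⟩
  | create i pc hpc ho hi =>
    refine ⟨fun j hj => ?_, fun j pt hj => ?_⟩ <;> obtain rfl | hji := eq_or_ne j i
    · simp at hj
    · simp only [Function.update_of_ne hji] at hj ⊢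
      exact hs.owner_eq_none j hj
    · simp only [Function.update_self, Option.some.injEq] at hj ⊢
      subst hj
      exact ⟨pc, hpc, pc.newPort_name.symm, pc.newPort_dir.symm, ho.symm⟩
    · simp only [Function.update_of_ne hji] at hj ⊢
      exact hs.configured j pt hj
  | modify i f hf hi => exact hs.modifyPort i hf

theorem cur_eq (h : HypercallEffect conf s p t) : t.cur = s.cur := by
  cases h <;> rfl

/-- Every port is on a channel, so that a hypercall of a partition that cannot interfere with the
transmitter does not change the ports. -/
theorem vpeq_trans (h : HypercallEffect conf s p t) (hconf : conf.WellFormed) (hs : s.Inv conf)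
    (hp : ¬ conf.PartIntfTrm p) : Vpeq .trans s t := by
  cases h with
  | none => exact ⟨rfl, rfl⟩
  | mode m => exact ⟨rfl, rfl⟩
  | create i pc hpc ho hi =>
    obtain ⟨c, hc, hc'⟩ := hconf.port_on_channel i pc hpc
    exact absurd ⟨i, pc, c, hpc, ho, hc, hc'⟩ hp
  | modify i f hf hi => exact absurd (hs.partIntfTrm hconf hi) hp

theorem vpeq_part (h : HypercallEffect conf s p t) (hs : s.Inv conf) {q : P} (hq : p ≠ q) :
    Vpeq (.part q) s t := by
  cases h with
  | none => exact (vpeq_equivalence _).refl _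
  | mode m => exact ⟨(Function.update_of_ne hq.symm _ _).symm, .of_comm_eq (fun _ => Iff.rfl)
      fun _ _ => rfl⟩
  | create i pc hpc ho hi =>
    have hne : ∀ j, s.IsPortOf j q → j ≠ i := by
      rintro j hj rfl
      exact absurd (hj.symm.trans (hs.owner_eq_none j hi)) nofun
    refine ⟨rfl, .of_comm_eq (fun j => ?_) fun j hj => ?_⟩
    · refine ⟨fun hj => (Function.update_of_ne (hne j hj) _ _).trans hj, fun hj => ?_⟩
      obtain rfl | hji := eq_or_ne j i
      · have hj' : Function.update s.partPorts j (some p) j = some q := hj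
        rw [Function.update_self] at hj'
        exact absurd (Option.some.inj hj') hq
      · exact (Function.update_of_ne hji _ _).symm.trans hj
    · exact (Function.update_of_ne (hne j hj) _ _).symm
  | modify i f hf hi =>
    exact ⟨rfl, vpeqPartComm_modifyPort hf fun hi' =>
      absurd (Option.some.inj (hi.symm.trans hi')) hq⟩

end HypercallEffect

theorem Vpeq.ite_fst {d : Domain P} {α : Type} {c c' : Prop} [Decidable c] [Decidable c']
    {x y x' y' : State P Msg × α} (hc : c ↔ c') (hx : Vpeq d x.1 x'.1) (hy : Vpeq d y.1 y'.1) :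
    Vpeq d (if c then x else y).1 (if c' then x' else y').1 := by
  by_cases h : c
  · rwa [if_pos h, if_pos (hc.1 h)]
  · rwa [if_neg h, if_neg (mt hc.2 h)]

theorem Vpeq.modifyPort_trans {s t : State P Msg} (h : Vpeq .trans s t) (i : PortId)
    (f : PortState Msg → PortState Msg) : Vpeq .trans (s.modifyPort i f) (t.modifyPort i f) :=
  ⟨by rw [State.modifyPort, State.modifyPort, h.1], h.2⟩

theorem createPort_vpeq_trans {s t : State P Msg} {p : P} (h : Vpeq .trans s t)
    (hp : s.partitions p = t.partitions p) (x : PortId × PortConf P) :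
    Vpeq .trans (createPort s p x).1 (createPort t p x).1 :=
  Vpeq.ite_fst (by rw [h.1, hp])
    ⟨congrArg (fun c => Function.update c x.1 (some (x.2.newPort Msg))) h.1,
      congrArg (fun o => Function.update o x.1 (some p)) h.2⟩ h

/-- The ports, and the mode of the calling partition, determine the ports after a hypercall. -/
theorem execHypercall_vpeq_trans {s t : State P Msg} {p : P} (h : Vpeq .trans s t)
    (hp : s.partitions p = t.partitions p) (hc : Hypercall Msg) :
    Vpeq .trans (execHypercall conf s p hc) (execHypercall conf t p hc) := by
  have hcreate := createPort_vpeq_trans h hp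
  have howner (i : PortId) : s.IsPortOf i p ↔ t.IsPortOf i p := by
    rw [State.IsPortOf, State.IsPortOf, h.2]
  have hq (i : PortId) : s.IsQueuingPort i ↔ t.IsQueuingPort i := by
    rw [State.IsQueuingPort, State.IsQueuingPort, h.1]
  have hsm (i : PortId) : s.IsSamplingPort i ↔ t.IsSamplingPort i := by
    rw [State.IsSamplingPort, State.IsSamplingPort, h.1]
  have hsrc (i : PortId) : s.IsSourcePort i ↔ t.IsSourcePort i := by
    rw [State.IsSourcePort, State.IsSourcePort, h.1]
  have hdst (i : PortId) : s.IsDestPort i ↔ t.IsDestPort i := by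
    rw [State.IsDestPort, State.IsDestPort, h.1]
  have hfull (i : PortId) : s.IsFullPort i ↔ t.IsFullPort i := by
    rw [State.IsFullPort, State.IsFullPort, h.1]
  have hmsg (i : PortId) : s.HasMsg i ↔ t.HasMsg i := by
    rw [State.HasMsg, State.HasMsg, h.1]
  cases hc with
  | createSamplingPort n =>
    simp only [execHypercall, createSamplingPort]
    split
    exacts [.ite_fst Iff.rfl (hcreate _) h, h]
  | createQueuingPort n =>
    simp only [execHypercall, createQueuingPort]
    split
    exacts [.ite_fst Iff.rfl (hcreate _) h, h]
  | writeSamplingMessage i m =>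
    exact .ite_fst (by rw [hsm, hsrc, howner]) h (h.modifyPort_trans i _)
  | readSamplingMessage i =>
    exact .ite_fst (by rw [hsm, hdst, howner]) h h
  | sendQueuingMessage i m =>
    exact .ite_fst (by rw [hq, hsrc, howner]) h (.ite_fst (hfull i) h (h.modifyPort_trans i _))
  | receiveQueuingMessage i =>
    exact .ite_fst (by rw [hq, hdst, howner, hmsg]) h (h.modifyPort_trans i _)
  | clearQueuingPort i =>
    exact .ite_fst (by rw [hq, hdst, howner]) h (h.modifyPort_trans i _)
  | setPartitionMode m =>
    simp only [execHypercall, setPartitionMode, hp]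
    split_ifs <;> exact h
  | _ => exact h

/-- A configured port of `p` that has been created is owned by `p`; so `p` observes whether it can
still be created. -/
theorem State.Inv.comm_eq_none_iff {s : State P Msg} (hs : s.Inv conf) {i : PortId}
    {pc : PortConf P} (hpc : conf.ports i = some pc) :
    s.comm i = none ↔ ¬ s.IsPortOf i pc.owner := by
  cases hc : s.comm i with
  | none => simp [IsPortOf, hs.owner_eq_none i hc]
  | some pt =>
    obtain ⟨pc', h1, -, -, h4⟩ := hs.configured i pt hc
    obtain rfl := Option.some.inj (hpc.symm.trans h1)
    simp [IsPortOf, h4]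

theorem createPort_vpeq_part {s t : State P Msg} {p : P} (hs : s.Inv conf) (ht : t.Inv conf)
    (h : Vpeq (.part p) s t) {n : PortName} {x : PortId × PortConf P}
    (hx : conf.cfgPort p n = some x) :
    Vpeq (.part p) (createPort s p x).1 (createPort t p x).1 := by
  obtain ⟨h1, -, rfl⟩ := SysConfig.cfgPort_eq_some hx
  obtain ⟨i, pc⟩ := x
  obtain ⟨hm, hp, hq⟩ := h
  have hiff : s.comm i = none ↔ t.comm i = none := by
    rw [hs.comm_eq_none_iff h1, ht.comm_eq_none_iff h1, hp i]
  simp only [createPort, hiff, hm]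
  split_ifs
  · refine ⟨hm, fun j => ?_, fun j hj => ?_⟩ <;> obtain rfl | hji := eq_or_ne j i
    · simp [State.IsPortOf]
    · simpa [State.IsPortOf, hji] using hp j
    · simp [State.IsQueuingPort, State.IsDestPort, State.msgsOf]
    · replace hj : s.IsPortOf j pc.owner := by simpa [State.IsPortOf, hji] using hj
      simpa [State.IsQueuingPort, State.IsDestPort, State.msgsOf, hji] using hq j hj
  · exact ⟨hm, hp, hq⟩

theorem State.not_isDestPort {s : State P Msg} {i : PortId} (h : s.IsSourcePort i) :
    ¬ s.IsDestPort i := by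
  rintro ⟨pt, h1, h2⟩
  obtain ⟨pt', h3, h4⟩ := h
  obtain rfl := Option.some.inj (h1.symm.trans h3)
  exact absurd (h2.symm.trans h4) nofun

theorem State.hasMsg_iff {s : State P Msg} {i : PortId} :
    s.HasMsg i ↔ (s.msgsOf i).length ≠ 0 := by
  unfold HasMsg msgsOf
  cases s.comm i <;> simp

/-- The guards of the services for received messages are observable by the calling partition. -/
theorem VpeqPartComm.guard_iff {s t : State P Msg} {p : P} (h : VpeqPartComm s p t) (i : PortId) :
    (¬ s.IsQueuingPort i ∨ ¬ s.IsDestPort i ∨ ¬ s.IsPortOf i p) ↔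
      (¬ t.IsQueuingPort i ∨ ¬ t.IsDestPort i ∨ ¬ t.IsPortOf i p) := by
  have h1 := h.1 i
  by_cases hi : s.IsPortOf i p
  · have := h.2 i hi
    tauto
  · tauto

/-- Writing to a source port cannot be observed by the owner of the port, which sees the number of
messages in destination ports only. -/
theorem vpeq_part_write (s : State P Msg) (p : P) (i : PortId) (m : Msg) :
    Vpeq (.part p) s (writeSamplingMessage s p i m).1 ∧
      Vpeq (.part p) s (sendQueuingMessage s p i m).1 := by
  have hE := vpeq_equivalence (Msg := Msg) (.part p)
  have hw : s.IsSourcePort i → Vpeq (.part p) s (s.modifyPort i (PortState.insert m)) := fun h =>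
    ⟨rfl, vpeqPartComm_modifyPort (PortState.regular_insert m) fun _ => State.not_isDestPort h⟩
  unfold writeSamplingMessage sendQueuingMessage
  constructor
  · split_ifs
    exacts [hE.refl _, hw (by tauto)]
  · split_ifs
    exacts [hE.refl _, hE.refl _, hw (by tauto)]

theorem execHypercall_vpeq_part {s t : State P Msg} {p : P} (hs : s.Inv conf) (ht : t.Inv conf)
    (h : Vpeq (.part p) s t) (hc : Hypercall Msg) :
    Vpeq (.part p) (execHypercall conf s p hc) (execHypercall conf t p hc) := by
  have hE := vpeq_equivalence (Msg := Msg) (.part p)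
  cases hc with
  | createSamplingPort n =>
    simp only [execHypercall, createSamplingPort]
    split
    exacts [.ite_fst Iff.rfl (createPort_vpeq_part hs ht h ‹_›) h, h]
  | createQueuingPort n =>
    simp only [execHypercall, createQueuingPort]
    split
    exacts [.ite_fst Iff.rfl (createPort_vpeq_part hs ht h ‹_›) h, h]
  | writeSamplingMessage i m =>
    simp only [execHypercall]
    exact hE.trans (hE.symm (vpeq_part_write s p i m).1)
      (hE.trans h (vpeq_part_write t p i m).1)
  | sendQueuingMessage i m =>
    simp only [execHypercall]
    exact hE.trans (hE.symm (vpeq_part_write s p i m).2)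
      (hE.trans h (vpeq_part_write t p i m).2)
  | readSamplingMessage i =>
    simp only [execHypercall, readSamplingMessage]
    split_ifs <;> exact h
  | receiveQueuingMessage i =>
    have hg := h.2.guard_iff i
    have hiff : (¬ s.IsQueuingPort i ∨ ¬ s.IsDestPort i ∨ ¬ s.IsPortOf i p ∨ ¬ s.HasMsg i) ↔
        (¬ t.IsQueuingPort i ∨ ¬ t.IsDestPort i ∨ ¬ t.IsPortOf i p ∨ ¬ t.HasMsg i) := by
      simp only [← or_assoc] at hg ⊢
      rw [hg]
      refine or_congr_right' fun hn => ?_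
      simp only [not_or, not_not] at hn
      have hi := (h.2.1 i).2 hn.2
      have hm := h.2.2 i hi
      rw [State.hasMsg_iff, State.hasMsg_iff, hm.2.2 (hm.2.1.2 hn.1.2)]
    exact .ite_fst hiff h ⟨h.1, h.2.modifyPort i PortState.regular_removeFirst⟩
  | clearQueuingPort i =>
    exact .ite_fst (h.2.guard_iff i) h ⟨h.1, h.2.modifyPort i PortState.regular_clear⟩
  | setPartitionMode m =>
    simp only [execHypercall, setPartitionMode, h.1]
    split_ifs
    · exact ⟨by simp, h.2⟩
    · exact h
  | _ => exact h

/-! ### Message transmission -/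

theorem transferSampling_eq {s : State P Msg} {c : Channel} :
    transferSampling s c = s ∨ ∃ m, transferSampling s c = { s with
      comm := fun i => (s.comm i).map fun pt => if pt.name ∈ c.dsts then pt.insert m else pt } := by
  cases c with
  | queuing => exact .inl rfl
  | sampling c sn dns =>
    simp only [transferSampling]
    split
    · split
      · exact .inr ⟨_, rfl⟩
      · exact .inl rfl
    · exact .inl rfl

theorem State.Inv.transferSampling {s : State P Msg} (hs : s.Inv conf) (c : Channel) :
    (transferSampling s c).Inv conf := by
  obtain h | ⟨m, h⟩ := transferSampling_eq (s := s) (c := c)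
  · rwa [h]
  · rw [h]
    refine hs.of_map rfl (fun _ => rfl) ?_ ?_ <;> intro _ pt <;> split_ifs
    exacts [(PortState.regular_insert m).name pt, rfl, (PortState.regular_insert m).dir pt, rfl]

theorem State.Inv.transferQueuing {s : State P Msg} (hs : s.Inv conf) (c : Channel) :
    (transferQueuing s c).Inv conf := by
  cases c with
  | sampling => exact hs
  | queuing c sn dn =>
    simp only [ArincSK.transferQueuing]
    split
    · next sp dp hsp hdp =>
      split
      · have h' := hs.modifyPort sp PortState.regular_removeFirst
        split_ifs
        exacts [h', h'.modifyPort _ (PortState.regular_insert _)]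
      · exact hs
    · exact hs

theorem transferSampling_frame (s : State P Msg) (c : Channel) :
    (transferSampling s c).cur = s.cur ∧ (transferSampling s c).partitions = s.partitions := by
  obtain h | ⟨m, h⟩ := transferSampling_eq (s := s) (c := c) <;> rw [h] <;> exact ⟨rfl, rfl⟩

theorem transferQueuing_frame (s : State P Msg) (c : Channel) :
    (transferQueuing s c).cur = s.cur ∧ (transferQueuing s c).partitions = s.partitions := by
  cases c with
  | sampling => exact ⟨rfl, rfl⟩
  | queuing c sn dn =>
    simp only [transferQueuing]
    split
    · split
      · split_ifs <;> exact ⟨rfl, rfl⟩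
      · exact ⟨rfl, rfl⟩
    · exact ⟨rfl, rfl⟩

theorem transferSampling_vpeq_trans {s t : State P Msg} (h : Vpeq .trans s t) (c : Channel) :
    Vpeq .trans (transferSampling s c) (transferSampling t c) := by
  obtain ⟨h1, h2⟩ := h
  cases c with
  | queuing => exact ⟨h1, h2⟩
  | sampling c sn dns =>
    simp only [transferSampling, State.portIdByName_congr h1, State.msgsOf, h1]
    split
    · split
      exacts [⟨rfl, h2⟩, ⟨h1, h2⟩]
    · exact ⟨h1, h2⟩

theorem transferQueuing_vpeq_trans {s t : State P Msg} (h : Vpeq .trans s t) (c : Channel) :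
    Vpeq .trans (transferQueuing s c) (transferQueuing t c) := by
  obtain ⟨h1, h2⟩ := h
  cases c with
  | sampling => exact ⟨h1, h2⟩
  | queuing c sn dn =>
    simp only [transferQueuing, State.portIdByName_congr h1, State.msgsOf, h1]
    split
    · next sp dp hsp hdp =>
      split
      · have h' := Vpeq.modifyPort_trans ⟨h1, h2⟩ sp PortState.removeFirst
        have hfull : (s.modifyPort sp PortState.removeFirst).IsFullPort dp ↔
            (t.modifyPort sp PortState.removeFirst).IsFullPort dp := by
          rw [State.IsFullPort, State.IsFullPort, h'.1]
        simp only [hfull]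
        split_ifs
        exacts [h', h'.modifyPort_trans dp _]
      · exact ⟨h1, h2⟩
    · exact ⟨h1, h2⟩

theorem transferSampling_vpeq_part {s : State P Msg} (hs : s.Inv conf) {c : Channel}
    (hc : c ∈ conf.channels) {p : P} (hp : ¬ conf.TrmIntfPart p) :
    Vpeq (.part p) s (transferSampling s c) := by
  obtain h | ⟨m, h⟩ := transferSampling_eq (s := s) (c := c)
  · rw [h]
    exact (vpeq_equivalence _).refl s
  · rw [h]
    refine ⟨rfl, .of_comm_eq (fun _ => Iff.rfl) fun i hi => ?_⟩
    cases hpt : s.comm i with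
    | none => simp [hpt]
    | some pt =>
      have hn : pt.name ∉ c.dsts := fun hn => hp (hs.trmIntfPart hi hc hpt hn)
      simp [hpt, hn]

/-- A partition that the transmitter cannot interfere with owns at most the source port of the
channel, and does not observe the messages in it. -/
theorem transferQueuing_vpeq_part (hconf : conf.WellFormed) {s : State P Msg} (hs : s.Inv conf)
    {c : Channel} (hc : c ∈ conf.channels) {p : P} (hp : ¬ conf.TrmIntfPart p) :
    Vpeq (.part p) s (transferQueuing s c) := by
  have hE := vpeq_equivalence (Msg := Msg) (.part p)
  cases c with
  | sampling => exact hE.refl s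
  | queuing c sn dn =>
    simp only [transferQueuing]
    split
    · next sp dp hsp hdp =>
      obtain ⟨spt, hspt, hsn⟩ := State.portIdByName_eq_some hsp
      obtain ⟨dpt, hdpt, hdn⟩ := State.portIdByName_eq_some hdp
      have hsrc : ¬ s.IsDestPort sp := by
        obtain ⟨i, pc, n, h1, h2, h3, -⟩ := hconf.queuing_src c sn dn hc
        obtain ⟨pc', h4, h5, h6, -⟩ := hs.configured sp spt hspt
        obtain rfl := hconf.name_unique _ _ _ _ h1 h4 (by rw [h2, h5, hsn])
        obtain rfl := Option.some.inj (h1.symm.trans h4)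
        exact State.not_isDestPort ⟨spt, hspt, h6.symm.trans h3⟩
      have hdst : ¬ s.IsPortOf dp p := fun hi => hp (hs.trmIntfPart hi hc hdpt hdn)
      split
      · have h1 : Vpeq (.part p) s (s.modifyPort sp PortState.removeFirst) :=
          ⟨rfl, vpeqPartComm_modifyPort PortState.regular_removeFirst fun _ => hsrc⟩
        split_ifs
        · exact h1
        · exact hE.trans h1
            ⟨rfl, vpeqPartComm_modifyPort (PortState.regular_insert _) fun hi => absurd hi hdst⟩
      · exact hE.refl s
    · exact hE.refl s

/-! ### Unwinding of the top level -/

theorem execEvent_inv {s t : State P Msg} {e : Event Msg} (hs : s.Inv conf)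
    (h : t ∈ execEvent conf e s) : t.Inv conf := by
  rcases e with hc | (_ | c | c) <;> simp only [execEvent] at h
  · split at h <;> obtain rfl := h
    exacts [(hypercallEffect conf s _ hc).inv hs, hs]
  · obtain rfl := h
    exact ⟨hs.owner_eq_none, hs.configured⟩
  · split_ifs at h <;> obtain rfl := h
    exacts [hs.transferSampling c, hs]
  · split_ifs at h <;> obtain rfl := h
    exacts [hs.transferQueuing c, hs]

theorem inv_of_reachable {s : State P Msg} (hs : (topSpec Msg conf).model.Reachable s) :
    s.Inv conf :=
  hs.induction (p := State.Inv conf) State.inv_init fun _ _ _ hs h => execEvent_inv hs h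

/-- A step on both sides that changes ports only, and leads to the same ports, preserves the
equivalence of every domain. -/
theorem vpeq_of_vpeq_trans {s t s' t' : State P Msg} {d : Domain P} (hd : Vpeq d s t)
    (h : Vpeq .trans s' t') (hs : s'.cur = s.cur ∧ s'.partitions = s.partitions)
    (ht : t'.cur = t.cur ∧ t'.partitions = t.partitions) : Vpeq d s' t' := by
  cases d with
  | sched => exact hs.1.trans (Eq.trans hd ht.1.symm)
  | trans => exact h
  | part p =>
    refine ⟨by rw [hs.2, ht.2]; exact hd.1, .of_comm_eq (fun i => ?_) fun i _ => by rw [h.1]⟩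
    rw [State.IsPortOf, State.IsPortOf, h.2]

theorem topSpec_unwinding (Msg : Type) (hconf : conf.WellFormed) :
    (topSpec Msg conf).model.Unwinding where
  stepConsistent := by
    intro e d s t hs ht hd hS w hw hi hwe s' t' hs' ht'
    replace hs := inv_of_reachable hs
    replace ht := inv_of_reachable ht
    change Vpeq d s t at hd
    change s.cur = t.cur at hS
    change Vpeq w s t at hwe
    change conf.Interference w d at hi
    change eventDomain s e = some w at hw
    change s' ∈ execEvent conf e s at hs'
    change t' ∈ execEvent conf e t at ht'
    change Vpeq d s' t'
    rcases e with hc | (_ | c | c) <;> simp only [execEvent, ← hS] at hs' ht'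
    · obtain rfl : s.cur = w := Option.some.inj hw
      cases hcur : s.cur with
      | part p =>
        rw [hcur] at hi hwe
        simp only [hcur] at hs' ht'
        obtain rfl := hs'
        obtain rfl := ht'
        cases d with
        | sched => exact hi.elim
        | trans => exact execHypercall_vpeq_trans hd hwe.1 hc
        | part q =>
          obtain rfl : p = q := hi
          exact execHypercall_vpeq_part hs ht hd hc
      | _ =>
        simp only [hcur] at hs' ht'
        obtain rfl := hs'
        obtain rfl := ht'
        exact hd
    · obtain rfl := hs'
      obtain rfl := ht'
      -- Scheduling changes `cur` only, which no domain other than the scheduler observes.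
      cases d with
      | sched => exact congrArg conf.next hS
      | _ => exact hd
    · obtain rfl : Domain.trans = w := Option.some.inj hw
      split_ifs at hs' ht' <;> obtain rfl := hs' <;> obtain rfl := ht'
      · exact vpeq_of_vpeq_trans hd (transferSampling_vpeq_trans hwe c)
          (transferSampling_frame s c) (transferSampling_frame t c)
      · exact hd
    · obtain rfl : Domain.trans = w := Option.some.inj hw
      split_ifs at hs' ht' <;> obtain rfl := hs' <;> obtain rfl := ht'
      · exact vpeq_of_vpeq_trans hd (transferQueuing_vpeq_trans hwe c)
          (transferQueuing_frame s c) (transferQueuing_frame t c)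
      · exact hd
  locallyRespects := by
    intro e d s s' hs hn hs'
    replace hs := inv_of_reachable hs
    have hE := vpeq_equivalence (Msg := Msg) d
    change s' ∈ execEvent conf e s at hs'
    change ¬ ∃ w, eventDomain s e = some w ∧ conf.Interference w d at hn
    change Vpeq d s s'
    rcases e with hc | (_ | c | c) <;> simp only [execEvent] at hs'
    · replace hn : ¬ conf.Interference s.cur d := fun h => hn ⟨_, rfl, h⟩
      cases hcur : s.cur with
      | part p =>
        rw [hcur] at hn
        simp only [hcur] at hs'
        obtain rfl := hs'
        have he := hypercallEffect conf s p hc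
        cases d with
        | sched => exact he.cur_eq.symm
        | trans => exact he.vpeq_trans hconf hs hn
        | part q => exact he.vpeq_part hs hn
      | _ =>
        simp only [hcur] at hs'
        obtain rfl := hs'
        exact hE.refl _
    · exact absurd ⟨_, rfl, trivial⟩ hn
    · replace hn : ¬ conf.Interference .trans d := fun h => hn ⟨_, rfl, h⟩
      split_ifs at hs' with hg <;> obtain rfl := hs'
      · cases d with
        | sched => exact (transferSampling_frame s c).1.symm
        | trans => exact absurd trivial hn
        | part p => exact transferSampling_vpeq_part hs hg.2 hn
      · exact hE.refl _
    · replace hn : ¬ conf.Interference .trans d := fun h => hn ⟨_, rfl, h⟩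
      split_ifs at hs' with hg <;> obtain rfl := hs'
      · cases d with
        | sched => exact (transferQueuing_frame s c).1.symm
        | trans => exact absurd trivial hn
        | part p => exact transferQueuing_vpeq_part hconf hs hg.2 hn
      · exact hE.refl _

end TopLevel

section SecondLevel

open scoped Classical

variable {P Msg : Type} {conf : SysConfig P}

/-! ### Operations on the processes of one partition -/

/-- Agreement of two states on everything that operations on the processes of `p` depend on. -/
def SameProcs (p : P) (s t : StateR P Msg) : Prop :=
  s.partitions p = t.partitions p ∧ VpeqΔ (.part p) s t

/-- An operation on the processes of partition `p`: its effect is determined by the mode and the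
processes of `p`, and it changes neither the processes of other partitions nor the state of the top
level. -/
structure ProcLocal (p : P) (f : StateR P Msg → StateR P Msg) : Prop where
  toState : ∀ s, (f s).toState = s.toState
  congr : ∀ {s t}, SameProcs p s t → VpeqΔ (.part p) (f s) (f t)
  frame : ∀ s q, p ≠ q → VpeqΔ (.part q) s (f s)

theorem vpeqΔ_equivalence (d : Domain P) : Equivalence (VpeqΔ (Msg := Msg) d) := by
  cases d with
  | part p =>
    exact ⟨fun _ => ⟨rfl, fun _ => rfl, rfl⟩,
      fun h => ⟨h.1.symm, fun q => (h.2.1 q).symm, h.2.2.symm⟩,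
      fun h h' => ⟨h.1.trans h'.1, fun q => (h.2.1 q).trans (h'.2.1 q), h.2.2.trans h'.2.2⟩⟩
  | _ => exact ⟨fun _ => trivial, fun _ => trivial, fun _ _ => trivial⟩

theorem SameProcs.hasProc_iff {p : P} {s t : StateR P Msg} (h : SameProcs p s t) (q : ProcId)
    (st : ProcState) : s.HasProc p q st ↔ t.HasProc p q st := by
  rw [StateR.HasProc, StateR.HasProc, h.2.1, h.2.2.1 q]

namespace ProcLocal

variable {p : P} {f g : StateR P Msg → StateR P Msg}

theorem sameProcs (hf : ProcLocal p f) {s t : StateR P Msg} (h : SameProcs p s t) :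
    SameProcs p (f s) (f t) :=
  ⟨by rw [hf.toState, hf.toState]; exact h.1, hf.congr h⟩

theorem id : ProcLocal p (fun s : StateR P Msg => s) :=
  ⟨fun _ => rfl, fun h => h.2, fun s q _ => (vpeqΔ_equivalence (.part q)).refl s⟩

theorem comp (hg : ProcLocal p g) (hf : ProcLocal p f) : ProcLocal p (fun s => g (f s)) where
  toState s := (hg.toState _).trans (hf.toState s)
  congr h := hg.congr (hf.sameProcs h)
  frame s q hq := (vpeqΔ_equivalence (.part q)).trans (hf.frame s q hq) (hg.frame _ q hq)

/-- An operation with a parameter that is determined by the processes of `p`. -/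
theorem param {α : Sort*} {f : α → StateR P Msg → StateR P Msg} {a : StateR P Msg → α}
    (ha : ∀ s t, SameProcs p s t → a s = a t) (hf : ∀ x, ProcLocal p (f x)) :
    ProcLocal p (fun s => f (a s) s) where
  toState s := (hf _).toState s
  congr {s t} h := by
    rw [ha s t h]
    exact (hf _).congr h
  frame s q hq := (hf _).frame s q hq

theorem ite {c : StateR P Msg → Prop} [∀ s, Decidable (c s)]
    (hc : ∀ s t, SameProcs p s t → (c s ↔ c t)) (hf : ProcLocal p f) (hg : ProcLocal p g) :
    ProcLocal p (fun s => if c s then f s else g s) := by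
  have := param (f := fun (x : Prop) s => if x then f s else g s) (a := c)
    (fun s t h => propext (hc s t h)) fun x => by
      by_cases hx : x
      · simpa only [if_pos hx] using hf
      · simpa only [if_neg hx] using hg
  convert this

theorem setProc (p : P) (q : ProcId) (st : ProcState) :
    ProcLocal p (fun s : StateR P Msg => s.setProc p q st) where
  toState s := rfl
  congr {s t} h := by
    refine ⟨h.2.1, fun q' => ?_, h.2.2.2⟩
    by_cases hq : q' = q
    · simp [StateR.setProc, hq]
    · simpa [StateR.setProc, hq] using h.2.2.1 q'
  frame s p' hp := ⟨rfl, fun q' => by simp [StateR.setProc, hp.symm], rfl⟩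

theorem modifyProc (p : P) (q : ProcId) (f : ProcState → ProcState) :
    ProcLocal p (fun s : StateR P Msg => s.modifyProc p q f) := by
  refine param (f := fun (o : Option ProcState) s => match o with
    | some st => if s.HasProc p q st then s.setProc p q (f st) else s
    | none => s) (a := fun s => s.procState (p, q)) (fun s t h => h.2.2.1 q) fun o => ?_
  cases o with
  | none => exact id
  | some st => exact ite (fun s t h => h.hasProc_iff q st) (setProc p q (f st)) id

theorem setCurProc (p : P) (o : Option ProcId) :
    ProcLocal p (fun s : StateR P Msg => { s with curProc := Function.update s.curProc p o }) where
  toState s := rfl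
  congr h := ⟨h.2.1, h.2.2.1, by simp⟩
  frame s q hq := ⟨rfl, fun _ => rfl, by simp [hq.symm]⟩

theorem dropCur (p : P) (q : ProcId) : ProcLocal p (fun s : StateR P Msg => s.dropCur p q) :=
  ite (fun s t h => by rw [h.2.2.2]) (setCurProc p none) id

theorem createProc (p : P) (priority : ℕ) :
    ProcLocal p (fun s : StateR P Msg => (createProc s p priority).1) where
  toState s := by
    unfold ArincSK.createProc
    split
    · split_ifs <;> rfl
    · rfl
  congr {s t} h := by
    have hid : VpeqΔ (.part p) s t := h.2
    obtain ⟨hm, h1, h2, h3⟩ := h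
    simp only [ArincSK.createProc, h1, hm]
    split
    · split_ifs
      · refine ⟨by simp, fun q => ?_, h3⟩
        simp only [Function.update_apply, h2]
      · exact hid
    · exact hid
  frame s q hq := by
    unfold ArincSK.createProc
    split
    · split_ifs
      · exact ⟨by simp [hq.symm], fun q' => by simp [hq.symm], rfl⟩
      · exact (vpeqΔ_equivalence (.part q)).refl s
    · exact (vpeqΔ_equivalence (.part q)).refl s

theorem execProcCall (p : P) (h : ProcCall) :
    ProcLocal p (fun s : StateR P Msg => execProcCall s p h) := by
  cases h with
  | createProc priority => exact createProc p priority
  | startProc q =>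
    exact param (f := fun m s => s.modifyProc p q fun st =>
      if st.state = .dormant then
        { st with state := if m = some PartMode.normal then .ready else .waiting }
      else st) (a := fun s => s.partitions p) (fun s t h => h.1) fun m => modifyProc p q _
  | stopProc q => exact (dropCur p q).comp (modifyProc p q _)
  | suspendProc q => exact (dropCur p q).comp (modifyProc p q _)
  | resumeProc q =>
    exact param (f := fun m s => s.modifyProc p q fun st =>
      if st.state = .waiting ∧ m = some PartMode.normal then { st with state := .ready }
      else st) (a := fun s => s.partitions p) (fun s t h => h.1) fun m => modifyProc p q _
  | setPriority q priority => exact modifyProc p q _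
  | getProcStatus q => exact id

theorem setRunToReady (p : P) : ProcLocal p (fun s : StateR P Msg => setRunToReady s p) := by
  refine param (f := fun (o : Option ProcId) s => match o with
    | some q => s.modifyProc p q (fun st =>
      if st.state = .running then { st with state := .ready } else st)
    | none => s) (a := fun s => s.curProc p) (fun s t h => h.2.2.2) fun o => ?_
  cases o with
  | none => exact id
  | some q => exact modifyProc p q _

theorem setProcsToNormal (p : P) :
    ProcLocal p (fun s : StateR P Msg => setProcsToNormal s p) where
  toState s := rfl
  congr h := ⟨h.2.1, fun q => by simp [ArincSK.setProcsToNormal, h.2.2.1 q], h.2.2.2⟩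
  frame s q hq := ⟨rfl, fun q' => by simp [ArincSK.setProcsToNormal, hq.symm], rfl⟩

theorem removePartitionResources (p : P) :
    ProcLocal p (fun s : StateR P Msg => removePartitionResources s p) where
  toState s := rfl
  congr h := by simp [VpeqΔ, ArincSK.removePartitionResources]
  frame s q hq := by simp [VpeqΔ, ArincSK.removePartitionResources, hq.symm]

end ProcLocal

theorem SameProcs.topReadyProcs_eq {p : P} {s t : StateR P Msg} (h : SameProcs p s t) :
    topReadyProcs s p = topReadyProcs t p := by
  have hr : readyProcs s p = readyProcs t p := by
    simp only [readyProcs, h.hasProc_iff]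
  simp only [topReadyProcs, h.hasProc_iff, hr, h.2.2.1]

/-- A ready process of partition `p` with the highest priority, if there is one, becomes running and
the current process. -/
noncomputable def selectProc (p : P) (s : StateR P Msg) : StateR P Msg :=
  if (topReadyProcs s p).Nonempty then
    let q := Classical.epsilon (fun q : ProcId => q ∈ topReadyProcs s p)
    { s.modifyProc p q (fun st => { st with state := .running }) with
      curProc := Function.update s.curProc p (some q) }
  else s

/-- Process scheduling in partition `p`, as a function on states. -/
noncomputable def scheduleIn (p : P) (s : StateR P Msg) : StateR P Msg :=
  if s.partitions p = some .normal then selectProc p (setRunToReady s p) else s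

theorem scheduleProc_of_cur {p : P} {s : StateR P Msg} (h : s.cur = .part p) :
    scheduleProc s = {scheduleIn p s} := by
  simp only [scheduleProc, h, scheduleIn, selectProc]
  split_ifs <;> rfl

theorem StateR.modifyProc_curProc (s : StateR P Msg) (p : P) (q : ProcId)
    (f : ProcState → ProcState) : (s.modifyProc p q f).curProc = s.curProc := by
  unfold modifyProc
  split
  · split_ifs <;> rfl
  · rfl

theorem ProcLocal.scheduleIn (p : P) : ProcLocal p (scheduleIn (Msg := Msg) p) := by
  have hsel (q : ProcId) : ProcLocal p fun s : StateR P Msg =>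
      { s.modifyProc p q (fun st => { st with state := .running }) with
        curProc := Function.update s.curProc p (some q) } := by
    have := (setCurProc (Msg := Msg) p (some q)).comp
      (modifyProc p q fun st => { st with state := .running })
    simpa only [StateR.modifyProc_curProc] using this
  have hselect : ProcLocal p (selectProc (Msg := Msg) p) :=
    ite (fun s t h => by rw [h.topReadyProcs_eq])
      (param (a := fun s => Classical.epsilon fun q : ProcId => q ∈ topReadyProcs s p)
        (fun s t h => by rw [h.topReadyProcs_eq]) hsel) id
  exact ite (fun s t h => by rw [h.1]) (hselect.comp (setRunToReady p)) id

/-! ### Events of the second level -/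

theorem execEventR_base {e : Event Msg} (he : ∀ m, e ≠ .hyperc (.setPartitionMode m))
    (s : StateR P Msg) : execEventR conf (.base e) s =
      {s' | ∃ u ∈ execEvent conf e s.toState, s' = { s with toState := u }} := by
  rcases e with hc | e
  · cases hc
    case setPartitionMode m => exact absurd rfl (he m)
    all_goals rfl
  · rfl

/-- A change of the partition mode is an operation on the processes of the partition, together with
the change of the mode at the top level. -/
theorem setPartitionModeR_eq (p : P) (m : PartMode) :
    ∃ f : StateR P Msg → StateR P Msg, ProcLocal p f ∧ ∀ s, setPartitionModeR s p m =
      { f s with toState := setPartitionMode s.toState p m } := by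
  let f : StateR P Msg → StateR P Msg := fun s =>
    if s.partitions p ≠ none ∧ ¬ (s.partitions p = some .coldStart ∧ m = .warmStart) then
      if m = .normal then setProcsToNormal s p
      else if s.partitions p = some .normal then removePartitionResources s p
      else s
    else s
  refine ⟨f, ?_, fun s => ?_⟩
  · exact .ite (fun s t h => by rw [h.1]) (.ite (fun _ _ _ => Iff.rfl) (.setProcsToNormal p)
      (.ite (fun s t h => by rw [h.1]) (.removePartitionResources p) .id)) .id
  · simp only [setPartitionModeR, setPartitionMode, f]
    split_ifs <;> rfl

theorem vpeqΔ_of_toState (d : Domain P) (s : StateR P Msg) (u : State P Msg) :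
    VpeqΔ d s { s with toState := u } := by
  cases d with
  | part p => exact ⟨rfl, fun _ => rfl, rfl⟩
  | _ => trivial

theorem vpeqΔ_of_mem_singleton {d : Domain P} {s s' : StateR P Msg} (h : s' ∈ ({s} : Set _)) :
    VpeqΔ d s s' := by
  obtain rfl := h
  exact (vpeqΔ_equivalence d).refl _

/-- The event `e` belongs to the executing domain. If this is a partition `p`, then `e` is an
operation on the processes of `p`, the same for all states, up to a change of the state of the top
level; otherwise `e` does not touch the new state variables. -/
structure IsProcEvent (conf : SysConfig P) (e : EventR Msg) : Prop where
  domain : ∀ s : StateR P Msg, eventDomainR s e = some s.cur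
  idle : ∀ (s s' : StateR P Msg) d, (∀ p, s.cur ≠ .part p) → s' ∈ execEventR conf e s →
    VpeqΔ d s s'
  active : ∀ p, ∃ f : StateR P Msg → StateR P Msg, ProcLocal p f ∧
    ∀ s s' d, s.cur = .part p → s' ∈ execEventR conf e s → VpeqΔ d (f s) s'

/-- Among the events of the top level, only the change of the partition mode touches the processes.
-/
theorem vpeqΔ_or_isProcEvent (conf : SysConfig P) (e : EventR Msg) :
    (∀ d s s', s' ∈ execEventR conf e s → VpeqΔ d s s') ∨ IsProcEvent conf e := by
  cases e with
  | base e =>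
    by_cases he : ∀ m, e ≠ .hyperc (.setPartitionMode m)
    · refine .inl fun d s s' h => ?_
      rw [execEventR_base he] at h
      obtain ⟨u, -, rfl⟩ := h
      exact vpeqΔ_of_toState d s u
    · push Not at he
      obtain ⟨m, rfl⟩ := he
      refine .inr ⟨fun s => rfl, fun s s' d hs h => ?_, fun p => ?_⟩
      · simp only [execEventR] at h
        exact vpeqΔ_of_mem_singleton h
      · obtain ⟨f, hf, hfm⟩ := setPartitionModeR_eq (Msg := Msg) p m
        refine ⟨f, hf, fun s s' d hs h => ?_⟩
        simp only [execEventR, hs, hfm] at h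
        obtain rfl := h
        exact vpeqΔ_of_toState d (f s) _
  | proc c =>
    refine .inr ⟨fun s => rfl, fun s s' d hs h => ?_, fun p => ⟨_, .execProcCall p c, ?_⟩⟩
    · simp only [execEventR] at h
      exact vpeqΔ_of_mem_singleton h
    · intro s s' d hs h
      simp only [execEventR, hs] at h
      exact vpeqΔ_of_mem_singleton h
  | scheduleProc =>
    refine .inr ⟨fun s => rfl, fun s s' d hs h => ?_, fun p => ⟨_, .scheduleIn p, ?_⟩⟩
    · simp only [execEventR, scheduleProc] at h
      exact vpeqΔ_of_mem_singleton h
    · intro s s' d hs h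
      simp only [execEventR, scheduleProc_of_cur hs] at h
      exact vpeqΔ_of_mem_singleton h

theorem secondSpec_stepConsistentΔ (conf : SysConfig P) (e : EventR Msg) :
    (secondSpec Msg conf).model.StepConsistentΔ VpeqΔ e := by
  intro d s t _ _ hd hS w hw hi _ s' t' hs' ht'
  change VpeqR d s t at hd
  change s' ∈ execEventR conf e s at hs'
  change t' ∈ execEventR conf e t at ht'
  have hE := vpeqΔ_equivalence (Msg := Msg) d
  have hcur : s.cur = t.cur := hS.1
  obtain h | h := vpeqΔ_or_isProcEvent conf e
  · exact hE.trans (hE.symm (h d s s' hs')) (hE.trans hd.2 (h d t t' ht'))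
  obtain rfl : s.cur = w := Option.some.inj ((h.domain s).symm.trans hw)
  by_cases hp : ∀ p, s.cur ≠ .part p
  · exact hE.trans (hE.symm (h.idle s s' d hp hs'))
      (hE.trans hd.2 (h.idle t t' d (hcur ▸ hp) ht'))
  push Not at hp
  obtain ⟨p, hp⟩ := hp
  obtain ⟨f, hf, hact⟩ := h.active p
  rw [hp] at hi
  cases d with
  | part q =>
    obtain rfl : p = q := hi
    exact hE.trans (hE.symm (hact s s' _ hp hs'))
      (hE.trans (hf.congr ⟨hd.1.1, hd.2⟩) (hact t t' _ (hcur ▸ hp) ht'))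
  | _ => trivial

theorem secondSpec_locallyRespectsΔ (conf : SysConfig P) (e : EventR Msg) :
    (secondSpec Msg conf).model.LocallyRespectsΔ VpeqΔ e := by
  intro d s s' _ hn hs'
  change s' ∈ execEventR conf e s at hs'
  obtain h | h := vpeqΔ_or_isProcEvent conf e
  · exact h d s s' hs'
  by_cases hp : ∀ p, s.cur ≠ .part p
  · exact h.idle s s' d hp hs'
  push Not at hp
  obtain ⟨p, hp⟩ := hp
  obtain ⟨f, hf, hact⟩ := h.active p
  cases d with
  | part q =>
    have hpq : p ≠ q := fun hpq => hn ⟨.part p, (h.domain s).trans (congrArg some hp), hpq⟩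
    exact (vpeqΔ_equivalence _).trans (hf.frame s q hpq) (hact s s' _ hp hs')
  | _ => trivial

theorem execEvent_nonempty (conf : SysConfig P) (e : Event Msg) (s : State P Msg) :
    (execEvent conf e s).Nonempty := by
  rcases e with hc | (_ | c | c) <;> simp only [execEvent]
  · split <;> exact Set.singleton_nonempty _
  · exact Set.singleton_nonempty _
  all_goals split_ifs <;> exact Set.singleton_nonempty _

theorem execEventR_nonempty (conf : SysConfig P) (e : EventR Msg) (s : StateR P Msg) :
    (execEventR conf e s).Nonempty := by
  cases e with
  | base e =>
    by_cases he : ∀ m, e ≠ .hyperc (.setPartitionMode m)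
    · rw [execEventR_base he]
      obtain ⟨u, hu⟩ := execEvent_nonempty conf e s.toState
      exact ⟨_, u, hu, rfl⟩
    · push Not at he
      obtain ⟨m, rfl⟩ := he
      simp only [execEventR]
      split <;> exact Set.singleton_nonempty _
  | proc c =>
    simp only [execEventR]
    split <;> exact Set.singleton_nonempty _
  | scheduleProc =>
    simp only [execEventR]
    cases hs : s.cur with
    | part p =>
      rw [scheduleProc_of_cur hs]
      exact Set.singleton_nonempty _
    | _ =>
      rw [scheduleProc, hs]
      exact Set.singleton_nonempty _

theorem secondSpec_isSM (Msg : Type) (conf : SysConfig P) :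
    (secondSpec Msg conf).model.IsSM where
  part_intf p₁ p₂ hne h := absurd h hne
  sched_intf d := trivial
  intf_sched d h := by
    cases d with
    | sched => rfl
    | _ => exact h.elim
  equivalence d :=
    ⟨fun s => ⟨(vpeq_equivalence d).refl _, (vpeqΔ_equivalence d).refl s⟩,
      fun h => ⟨(vpeq_equivalence d).symm h.1, (vpeqΔ_equivalence d).symm h.2⟩,
      fun h h' => ⟨(vpeq_equivalence d).trans h.1 h'.1, (vpeqΔ_equivalence d).trans h.2 h'.2⟩⟩
  kdom_sched s t e h := by
    have hcur : s.cur = t.cur := h.1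
    change eventDomainR s e = eventDomainR t e
    rcases e with (hc | (_ | c | c)) | c | _ <;> simp only [eventDomainR, eventDomain, hcur]
  enabled s e _ := execEventR_nonempty conf e s

theorem secondSpec_refines (Msg : Type) (conf : SysConfig P) :
    Refines (topSpec Msg conf).model (secondSpec Msg conf).model StateR.toState evtRel VpeqΔ where
  init := rfl
  surj a := ⟨.base a, rfl⟩
  simulation e a s t he h := by
    change t ∈ execEventR conf e s at h
    change t.toState ∈ execEvent conf a s.toState
    cases e with
    | base e =>
      obtain rfl : e = a := Option.some.inj he
      by_cases hm : ∀ m, e ≠ .hyperc (.setPartitionMode m)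
      · rw [execEventR_base hm] at h
        obtain ⟨u, hu, rfl⟩ := h
        exact hu
      · push Not at hm
        obtain ⟨m, rfl⟩ := hm
        simp only [execEventR] at h
        simp only [execEvent]
        cases hs : s.cur with
        | part p =>
          obtain ⟨f, -, hfm⟩ := setPartitionModeR_eq (Msg := Msg) p m
          simp only [hs, hfm] at h
          obtain rfl := h
          rfl
        | _ =>
          simp only [hs] at h
          obtain rfl := h
          rfl
    | _ => exact nomatch he
  silent e s t he h := by
    change t ∈ execEventR conf e s at h
    cases e with
    | base e => exact nomatch he
    | proc c =>
      simp only [execEventR] at h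
      split at h <;> obtain rfl := h
      exacts [(ProcLocal.execProcCall _ c).toState s, rfl]
    | scheduleProc =>
      simp only [execEventR] at h
      cases hs : s.cur with
      | part p =>
        rw [scheduleProc_of_cur hs] at h
        obtain rfl := h
        exact (ProcLocal.scheduleIn p).toState s
      | _ =>
        rw [scheduleProc, hs] at h
        obtain rfl := h
        rfl
  kdom e a s he := by
    cases e with
    | base e =>
      obtain rfl : e = a := Option.some.inj he
      rfl
    | _ => exact nomatch he
  intf d₁ d₂ := Iff.rfl
  equiv d s t := Iff.rfl

theorem secondSpec_unwinding (Msg : Type) (hconf : conf.WellFormed) :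
    (secondSpec Msg conf).model.Unwinding :=
  (secondSpec_refines Msg conf).unwinding (topSpec_unwinding Msg hconf)
    (secondSpec_stepConsistentΔ conf) (secondSpec_locallyRespectsΔ conf)
    fun d s => (vpeq_equivalence d).refl s

end SecondLevel

end ArincSK

theorem mainTheorem7 {P Msg : Type} (conf : ArincSK.SysConfig P) (hconf : conf.WellFormed) :
    (ArincSK.secondSpec Msg conf).model.IsSM ∧
    ArincSK.Refines (ArincSK.topSpec Msg conf).model (ArincSK.secondSpec Msg conf).model
      ArincSK.StateR.toState ArincSK.evtRel ArincSK.VpeqΔ ∧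
    (∀ e, (ArincSK.secondSpec Msg conf).model.StepConsistentΔ ArincSK.VpeqΔ e) ∧
    (∀ e, (ArincSK.secondSpec Msg conf).model.LocallyRespectsΔ ArincSK.VpeqΔ e) ∧
    (ArincSK.secondSpec Msg conf).model.Noninfluence ∧
    (ArincSK.secondSpec Msg conf).model.WeakNoninfluence ∧
    (ArincSK.secondSpec Msg conf).model.Nonleakage ∧
    (ArincSK.secondSpec Msg conf).model.NoninterferenceR ∧
    (ArincSK.secondSpec Msg conf).model.WeakNoninterferenceR ∧
    (ArincSK.secondSpec Msg conf).model.Noninterference ∧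
    (ArincSK.secondSpec Msg conf).model.WeakNoninterference := by
  have hM := ArincSK.secondSpec_isSM Msg conf
  have hU := ArincSK.secondSpec_unwinding Msg hconf
  exact ⟨hM, ArincSK.secondSpec_refines Msg conf, ArincSK.secondSpec_stepConsistentΔ conf,
    ArincSK.secondSpec_locallyRespectsΔ conf, hM.noninfluence hU, hM.weakNoninfluence hU,
    hM.nonleakage hU, hM.noninterferenceR hU, hM.weakNoninterferenceR hU, hM.noninterference hU,
    hM.weakNoninterference hU⟩
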